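/- Let $B$ be a finite non-empty left regular band, that is, a semigroup satisfying $x^2=x$ and $xyx=xy$, partially ordered by $a\le b\iff ba=a$. Let $\Lambda(B)=\{Bb\mid b\in B\}$ be its set of principal left ideals, ordered by inclusion, and for $X\in\Lambda(B)$ put $B_{\ge X}=\{a\in B\mid Ba\supseteq X\}$. For a poset $P$ let $\Delta(P)$ denote its order complex, the simplicial complex of non-empty finite chains of $P$. Assume that $B$ is connected, i.e. that $\Delta(B_{\ge X})$ is connected for every $X\in\Lambda(B)$. Fix for every $Y\in\Lambda(B)$ an element $e_Y\in B$ with $Be_Y=Y$, and for $X,Y\in \Lambda(B)$ put $\partial e_YB_{\ge X}=e_YB_{\ge X}\setminus\{e_Y\}$. Let $\Bbbk$ be a commutative ring with unit. Then the semigroup algebra $\Bbbk B$ has an identity element. For $X\in\Lambda(B)$ let $\Bbbk_X$ be the (unitary, left) $\Bbbk B$-module with underlying $\Bbbk$-module $\Bbbk$ on which $b\in B$ acts as the identity if $Bb\supseteq X$ and as $0$ otherwise. For all $X,Y\in\Lambda(B)$ and all $n\ge 0$ there are isomorphisms of $\Bbbk$-modules \begin{align*} \mathrm{Ext}^n_{\Bbbk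 B}(\Bbbk_X,\Bbbk_Y) &\cong \begin{cases}H^n(\Delta(e_YB_{\geq X}),\Delta(\partial e_YB_{\geq X});\Bbbk), & \text{if } Y\geq X,\\ 0, & \text{else,}\end{cases} \\ &\cong \begin{cases} \Bbbk, &\text{if } X=Y,\ n=0, \\ \widetilde H^{n-1}(\Delta(\partial e_YB_{\geq X});\Bbbk), & \text{if } Y> X,\ n\geq 1,\\ 0, & \text{else,}\end{cases} \end{align*} where $\widetilde H$ denotes reduced cohomology, with $\widetilde H^{-1}(K;\Bbbk)=\Bbbk$ if $K=\emptyset$ and $\widetilde H^{-1}(K;\Bbbk)=0$ otherwise. Suppose moreover that $\Bbbk$ is a field. Then: (a) The quiver of $\Bbbk B$ (whose vertices are the isomorphism classes of simple modules, with $\dim_\Bbbk\mathrm{Ext}^1_{\Bbbk B}(S,S')$ arrows from $S$ to $S'$) has vertex set $\Lambda(B)$: the modules $\Bbbk_X$ with $X\in\Lambda(B)$ are simple, and every simple $\Bbbk B$-module is isomorphic to $\Bbbk_X$ for exactly one $X$. There are no arrows $X\to Y$ unless $X<Y$, in which case the number of arrows $X\to Y$ is one fewer than the number of connected components of $\Delta(\partial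 e_YB_{\ge X})$. (b) The global dimension of $\Bbbk B$ is the largest $n$ such that $\widetilde H^{n-1}(\Delta(\partial e_YB_{\ge X});\Bbbk)\ne0$ for some $X,Y\in\Lambda(B)$ with $Y\ge X$; in particular, it is finite. -/

import Mathlib

open CategoryTheory

universe u

/-- A left regular band: a semigroup in which `x * x = x` and `x * y * x = x * y`. -/
class LeftRegularBand (B : Type u) extends Semigroup B where
  mul_self : ∀ x : B, x * x = x
  mul_mul_self : ∀ x y : B, x * y * x = x * y

namespace LRB

/-! ### Left regular bands: order, support, contractions -/

section Band

variable {B : Type u} [LeftRegularBand B]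

/-- The natural partial order: `a ≤ b` if and only if `b * a = a`
(equivalently, `a` lies in the principal right ideal of `b`). -/
instance natOrder : PartialOrder B where
  le a b := b * a = a
  le_refl a := LeftRegularBand.mul_self a
  le_trans a b c hab hbc := by
    change b * a = a at hab
    change c * b = b at hbc
    rw [← hab, ← mul_assoc, hbc]
  le_antisymm a b hab hba := by
    change b * a = a at hab
    change a * b = b at hba
    have h := LeftRegularBand.mul_mul_self a b
    rwa [hba, hab] at h

/-- The principal left ideal `Bb`. As `b` is idempotent, `b ∈ Bb`. -/
def leftIdeal (b : B) : Set B := {x | ∃ a : B, x = a * b}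

variable (B) in
/-- The support semilattice `Λ(B) = {Bb | b ∈ B}`, ordered by inclusion. -/
abbrev SupportSemilattice : Type u := {X : Set B // ∃ b : B, X = leftIdeal b}

/-- The contraction `B_{≥ X} = {a ∈ B | X ⊆ Ba}`. -/
def contraction (X : SupportSemilattice B) : Set B := {a | X.1 ⊆ leftIdeal a}

theorem mul_mem_contraction_iff (X : SupportSemilattice B) (a b : B) :
    a * b ∈ contraction X ↔ a ∈ contraction X ∧ b ∈ contraction X := by
  constructor
  · intro h
    refine ⟨fun x hx => ?_, fun x hx => ?_⟩
    · obtain ⟨y, rfl⟩ := h hx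
      exact ⟨y * (a * b), by rw [mul_assoc, LeftRegularBand.mul_mul_self]⟩
    · obtain ⟨y, rfl⟩ := h hx
      exact ⟨y * a, (mul_assoc _ _ _).symm⟩
  · rintro ⟨ha, hb⟩ x hx
    obtain ⟨y, hy⟩ := ha hx
    obtain ⟨z, hz⟩ := hb hx
    refine ⟨x, ?_⟩
    have h1 : x * a = x := by rw [hy, mul_assoc, LeftRegularBand.mul_self]
    have h2 : x * b = x := by rw [hz, mul_assoc, LeftRegularBand.mul_self]
    rw [← mul_assoc, h1, h2]

/-- The set `e B_{≥ X} = {e * a | a ∈ B_{≥ X}}`. -/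
def cell (e : B) (X : SupportSemilattice B) : Set B := {x | ∃ a ∈ contraction X, x = e * a}

/-- The set `∂ e B_{≥ X} = e B_{≥ X} \ {e}`. -/
def cellBoundary (e : B) (X : SupportSemilattice B) : Set B := cell e X \ {e}

end Band

/-! ### Order complexes and their cohomology -/

section OrderComplex

variable {P : Type u} [PartialOrder P]

/-- The `1`-skeleton of the order complex `Δ(S)` of a subset `S` of a poset: distinct elements are
adjacent if and only if they are comparable. The connected components of `Δ(S)` are those of this
graph, and `Δ(S)` is connected if and only if this graph is. -/
def comparabilityGraph (S : Set P) : SimpleGraph S :=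
  SimpleGraph.fromRel fun a b => a ≤ b

/-- The number of connected components of `Δ(S)` (for `S` finite). -/
noncomputable def numComponents (S : Set P) : ℕ :=
  Nat.card (comparabilityGraph S).ConnectedComponent

/-- The chains with `m` elements in `S`, written as strictly increasing `m`-tuples. For `m = q + 1`
these are the `q`-simplices of the order complex `Δ(S)`, each with the orientation given by the
order; for `m = 0` there is one chain, the empty simplex. -/
abbrev Chain (S : Set P) (m : ℕ) : Type u :=
  {s : Fin m → P // StrictMono s ∧ ∀ i, s i ∈ S}

/-- The face of a chain obtained by omitting its `i`-th element. -/
def Chain.face {S : Set P} {m : ℕ} (s : Chain S (m + 1)) (i : Fin (m + 1)) : Chain S m :=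
  ⟨fun j => s.1 (i.succAbove j),
    s.2.1.comp (Fin.strictMono_succAbove i), fun _ => s.2.2 _⟩

variable (k : Type u) [CommRing k]

/-- The simplicial coboundary `(δ f)(s) = ∑ i, (-1) ^ i f(∂ᵢ s)`. From `m = 0` to `m = 1` it is the
dual of the augmentation. -/
def coboundary (S : Set P) (m : ℕ) : (Chain S m → k) →ₗ[k] (Chain S (m + 1) → k) where
  toFun f s := ∑ i : Fin (m + 1), (-1) ^ (i : ℕ) * f (s.face i)
  map_add' f g := by
    funext s
    simp [mul_add, Finset.sum_add_distrib]
  map_smul' c f := by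
    funext s
    simp [Finset.mul_sum, mul_left_comm]

theorem coboundary_coboundary (S : Set P) (m : ℕ) :
    (coboundary k S (m + 1)).comp (coboundary k S m) = 0 := by
  refine LinearMap.ext fun f => funext fun s => ?_
  simp only [coboundary, LinearMap.comp_apply, LinearMap.coe_mk, AddHom.coe_mk,
    LinearMap.zero_apply, Pi.zero_apply, Finset.mul_sum, ← mul_assoc, ← pow_add]
  rw [← Finset.sum_product' Finset.univ Finset.univ
    fun (i : Fin (m + 1 + 1)) (j : Fin (m + 1)) => (-1 : k) ^ ((i : ℕ) + (j : ℕ)) *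
      f ((s.face i).face j)]
  refine Finset.sum_involution (fun p _ => (p.1.succAbove p.2, p.2.predAbove p.1)) ?_ ?_ ?_ ?_
  · rintro ⟨i, j⟩ -
    have h : ((s.face (i.succAbove j)).face (j.predAbove i) : Chain S m) = (s.face i).face j :=
      Subtype.ext <| funext fun l =>
        congrArg s.1 (Fin.succAbove_succAbove_succAbove_predAbove i j l)
    simp only [h, Fin.neg_one_pow_succAbove_add_predAbove]
    ring
  · rintro ⟨i, j⟩ - - h
    exact Fin.succAbove_ne i j (congrArg Prod.fst h)
  · intros
    simp
  · rintro ⟨i, j⟩ -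
    exact Prod.ext (Fin.succAbove_succAbove_predAbove i j) (Fin.predAbove_predAbove_succAbove i j)

/-- The augmented simplicial cochain complex of `Δ(S)`, shifted by one: the module in degree `m`
consists of the functions on the chains with `m` elements. -/
noncomputable def augmentedCochainComplex (S : Set P) : CochainComplex (ModuleCat.{u} k) ℕ :=
  CochainComplex.of (fun m => ModuleCat.of k (Chain S m → k))
    (fun m => ModuleCat.ofHom (coboundary k S m))
    (fun m => by rw [← ModuleCat.ofHom_comp, coboundary_coboundary]; rfl)

/-- The reduced cohomology of `Δ(S)`, with the degree shifted by one:
`shiftedReducedCohomology k S n` is the reduced cohomology of `Δ(S)` with coefficients in `k` in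
degree `n - 1`. For `n = 0` it is `k` if `S` is empty, and zero otherwise. -/
noncomputable def shiftedReducedCohomology (S : Set P) (n : ℕ) : ModuleCat.{u} k :=
  (augmentedCochainComplex k S).homology n

/-- The cochains on the chains with `m` elements of `S` that vanish on the chains contained
in `T`. -/
def relCochains (S T : Set P) (m : ℕ) : Submodule k (Chain S m → k) where
  carrier := {f | ∀ s : Chain S m, (∀ i, s.1 i ∈ T) → f s = 0}
  zero_mem' _ _ := rfl
  add_mem' hf hg s hs := by simp [hf s hs, hg s hs]
  smul_mem' c f hf s hs := by simp [hf s hs]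

theorem coboundary_mem_relCochains (S T : Set P) (m : ℕ) :
    ∀ f ∈ relCochains k S T m, coboundary k S m f ∈ relCochains k S T (m + 1) := by
  intro f hf s hs
  change ∑ i : Fin (m + 1), (-1 : k) ^ (i : ℕ) * f (s.face i) = 0
  refine Finset.sum_eq_zero fun i _ => ?_
  rw [hf (s.face i) fun j => hs _, mul_zero]

/-- The simplicial cochain complex of the pair `(Δ(S), Δ(T))`, for `T ⊆ S`: in degree `q` it
consists of the cochains on the `q`-simplices of `Δ(S)` that vanish on those of `Δ(T)`. -/
noncomputable def relCochainComplex (S T : Set P) : CochainComplex (ModuleCat.{u} k) ℕ :=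
  CochainComplex.of (fun q => ModuleCat.of k (relCochains k S T (q + 1)))
    (fun q => ModuleCat.ofHom
      ((coboundary k S (q + 1)).restrict (coboundary_mem_relCochains k S T (q + 1))))
    (fun q => by
      rw [← ModuleCat.ofHom_comp]
      refine congrArg ModuleCat.ofHom (LinearMap.ext fun f => Subtype.ext ?_)
      exact LinearMap.congr_fun (coboundary_coboundary k S (q + 1)) f.1)

/-- The relative cohomology of the pair `(Δ(S), Δ(T))`, for `T ⊆ S`, in degree `n`. -/
noncomputable def relCohomology (S T : Set P) (n : ℕ) : ModuleCat.{u} k :=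
  (relCochainComplex k S T).homology n

end OrderComplex

/-- A left regular band `B` is connected if `Δ(B_{≥ X})` is connected for all `X ∈ Λ(B)`. -/
def IsConnected (B : Type u) [LeftRegularBand B] : Prop :=
  ∀ X : SupportSemilattice B, (comparabilityGraph (contraction X)).Connected

/-! ### The semigroup algebra and its modules -/

section Algebra

/-- The semigroup algebra `kB` has a (two-sided) identity element. -/
class IsUnital (k B : Type u) [CommRing k] [LeftRegularBand B] : Prop where
  exists_one : ∃ η : MonoidAlgebra k B, ∀ x, η * x = x ∧ x * η = x

variable (k B : Type u) [CommRing k] [LeftRegularBand B]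

/-- If `kB` has an identity element, then it is a unital ring. -/
noncomputable instance ringOfIsUnital [IsUnital k B] : Ring (MonoidAlgebra k B) :=
  { (inferInstance : NonUnitalRing (MonoidAlgebra k B)) with
    one := Classical.choose (IsUnital.exists_one (k := k) (B := B))
    one_mul := fun x => (Classical.choose_spec (IsUnital.exists_one (k := k) (B := B)) x).1
    mul_one := fun x => (Classical.choose_spec (IsUnital.exists_one (k := k) (B := B)) x).2 }

noncomputable instance algebraOfIsUnital [IsUnital k B] : Algebra k (MonoidAlgebra k B) :=
  Algebra.ofModule (fun r x y => smul_mul_assoc r x y) (fun r x y => mul_smul_comm r x y)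

/-- The category of modules over an algebra over a commutative ring `k` is `k`-linear: `k` acts on
every module through the algebra. -/
noncomputable instance linearModuleCat {k A : Type u} [CommRing k] [Ring A] [Algebra k A] :
    Linear k (ModuleCat.{u} A) where
  homModule M N :=
    letI : Module k N := Module.restrictScalars k A N
    haveI : IsScalarTower k A N := IsScalarTower.restrictScalars k A N
    inferInstance
  smul_comp := by
    intro L M N r f g
    ext x
    exact map_smul g.hom (algebraMap k A r) (f.hom x)
  comp_smul := by
    intros
    rfl

open Classical in
/-- The multiplicative map `B → k` sending `b` to `1` if `X ⊆ Bb`, and to `0` otherwise. -/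
noncomputable def supportCharacter {B : Type u} [LeftRegularBand B] (X : SupportSemilattice B) :
    B →ₙ* k where
  toFun b := if b ∈ contraction X then 1 else 0
  map_mul' a b := by
    simp only [mul_mem_contraction_iff]
    split_ifs <;> simp_all

/-- The ring homomorphism `kB → k` extending `supportCharacter`. -/
noncomputable def supportRingHom {B : Type u} [LeftRegularBand B] [IsUnital k B]
    (X : SupportSemilattice B) : MonoidAlgebra k B →+* k :=
  let φ := MonoidAlgebra.liftMagma k (supportCharacter k X)
  { toFun := φ
    map_zero' := map_zero φ
    map_add' := map_add φ
    map_mul' := map_mul φ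
    map_one' := by
      change φ 1 = 1
      obtain ⟨b, hb⟩ := X.2
      have h : φ (MonoidAlgebra.single b 1) = 1 := by
        simp [φ, supportCharacter, contraction, hb]
      rw [← mul_one (φ 1), ← h, ← map_mul, one_mul] }

/-- The `kB`-module `k_X`: the `k`-module `k`, on which `b ∈ B` acts as the identity if `X ⊆ Bb`,
and as zero otherwise. -/
noncomputable def supportModule {B : Type u} [LeftRegularBand B] [IsUnital k B]
    (X : SupportSemilattice B) : ModuleCat.{u} (MonoidAlgebra k B) :=
  (ModuleCat.restrictScalars (supportRingHom k X)).obj (ModuleCat.of k k)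

end Algebra

/-- The (left) global dimension of a ring: the supremum of the projective dimensions of all
its modules. -/
noncomputable def globalDimension (A : Type u) [Ring A] : WithBot ℕ∞ :=
  ⨆ M : ModuleCat.{u} A, projectiveDimension M

/-- The number of arrows from `S` to `S'` in the quiver of a `k`-algebra `A`, for `k` a field and
`S`, `S'` simple modules: the dimension of `Ext¹(S, S')`. The vertices of the quiver are the
isomorphism classes of simple modules. -/
noncomputable def quiverArrows (k : Type u) {A : Type u} [CommRing k] [Ring A] [Algebra k A]
    (S S' : ModuleCat.{u} A) : Cardinal.{u} :=
  Module.rank k (Abelian.Ext S S' 1)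

end LRB

/-! ### Supports and the identity element of the semigroup algebra. -/

namespace LRB

/-! ### Supports in a left regular band -/

section Support

variable {B : Type u} [LeftRegularBand B]

/-! The simplicial chains of `Δ(B_{≥X})` form a projective resolution of `k_X`, and its morphisms
into `k_Y` are the augmented cochains of the boundary `∂e_Y B_{≥X}`.

Identity. Put `f_Y = e_Y - ∑_{Z<Y} e_Y f_Z`. Then `b f_Y = 0` unless `Y ≤ support b`, and `η = ∑
f_Y` is a right identity without any hypothesis. Connectedness makes it a left identity
(`mul_single_of_right_identity`): along comparable elements of `B_{≥V}`, the coefficients of `ηb -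
b` at an element of support `V` agree, and their common value is forced to vanish by `η² = η`.

Resolution. Left multiplication by `b ∈ B_{≥X}` is monotone, so `B` acts on the chains of `B_{≥X}`,
the other elements acting by zero. Since `bx ≤ b`, the action of each `b` factors through a cone
with apex `b` and is null-homotopic. The identity of `kB` is a combination of such `b` and acts as
the identity, so the augmented complex is exact (`exists_boundary_eq`). The elements `f_Z` split a
free cover of each chain module (`projective_chains`).

Morphisms. Let `f` be a morphism from chains to `k_Y`, and let `e = e_Y`. As `e` fixes `k_Y`, `f(t)
= f(et)`, so `f` is determined on chains of the cell `eB_{≥X}`. A chain with top element `x < e` is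
fixed by `x`, while `x` kills `k_Y`, so `f` vanishes on it. There remain the chains with top `e`,
that is, the chains of the boundary with one element fewer (`homEquivCochain`). These also index the
cochains of the cell relative to its boundary, so both forms of the answer come from one complex.

Over a field, every module is an iterated extension of isotypic ones, which are direct sums of
copies of some `k_X` (`isotypic_induction`, `exists_isotypic_linearEquiv`). This gives the simple
modules and bounds the global dimension by the nonvanishing of `Ext` between them. The arrows are
counted by reduced `H⁰`: functions on components modulo constants. -/

theorem mem_leftIdeal {b x : B} : x ∈ leftIdeal b ↔ x * b = x := by
  constructor
  · rintro ⟨a, rfl⟩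
    rw [mul_assoc, LeftRegularBand.mul_self]
  · intro h
    exact ⟨x, h.symm⟩

theorem self_mem_leftIdeal (b : B) : b ∈ leftIdeal b :=
  mem_leftIdeal.2 (LeftRegularBand.mul_self b)

theorem leftIdeal_subset {a b : B} : leftIdeal a ⊆ leftIdeal b ↔ a * b = a := by
  constructor
  · intro h
    exact mem_leftIdeal.1 (h (self_mem_leftIdeal a))
  · intro h x hx
    rw [mem_leftIdeal] at *
    rw [← hx, mul_assoc, h]

/-- The support of an element of a left regular band: the principal left ideal it generates. -/
def support (b : B) : SupportSemilattice B := ⟨leftIdeal b, b, rfl⟩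

theorem support_le {a b : B} : support a ≤ support b ↔ a * b = a := leftIdeal_subset

theorem mem_contraction {X : SupportSemilattice B} {b : B} :
    b ∈ contraction X ↔ X ≤ support b := Iff.rfl

theorem support_mul_le_right (a b : B) : support (a * b) ≤ support b :=
  support_le.2 (by rw [mul_assoc, LeftRegularBand.mul_self])

theorem support_mul_le_left (a b : B) : support (a * b) ≤ support a :=
  support_le.2 (LeftRegularBand.mul_mul_self a b)

theorem le_support_mul {X : SupportSemilattice B} {a b : B} :
    X ≤ support (a * b) ↔ X ≤ support a ∧ X ≤ support b :=
  mul_mem_contraction_iff X a b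

theorem support_eq_of_leftIdeal {Y : SupportSemilattice B} {b : B} (h : leftIdeal b = Y.1) :
    support b = Y := Subtype.ext h

theorem exists_support_eq (Y : SupportSemilattice B) : ∃ b : B, support b = Y := by
  obtain ⟨b, hb⟩ := Y.2
  exact ⟨b, Subtype.ext hb.symm⟩

theorem mul_eq_of_support_eq {a b : B} (h : support a = support b) : a * b = a :=
  support_le.1 h.le

theorem mul_le_left (a b : B) : a * b ≤ a := by
  change a * (a * b) = a * b
  rw [← mul_assoc, LeftRegularBand.mul_self]

theorem mul_monotone (b : B) : Monotone fun x : B => b * x := by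
  intro x y h
  change b * y * (b * x) = b * x
  have h' : y * x = x := h
  rw [← mul_assoc, LeftRegularBand.mul_mul_self, mul_assoc, h']

instance [Finite B] : Finite (SupportSemilattice B) :=
  Finite.of_surjective support fun Y => exists_support_eq Y

end Support

/-! ### The identity element of the semigroup algebra -/

theorem eq_sum_smul_single {k B : Type*} [CommRing k] [Fintype B] (x : MonoidAlgebra k B) :
    x = ∑ b, x.coeff b • MonoidAlgebra.single b (1 : k) := by
  ext b
  simp

theorem coeff_mul_single_eq {k B : Type*} [CommRing k] [Mul B] [Fintype B] [DecidableEq B] (x : MonoidAlgebra k B) (b v : B) :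
    (x * MonoidAlgebra.single b 1).coeff v = ∑ a with a * b = v, x.coeff a := by
  conv_lhs => rw [eq_sum_smul_single x]
  simp [Finset.sum_mul, Finsupp.finsetSum_apply, Finsupp.single_apply, Finset.sum_filter,
    MonoidAlgebra.single_mul_single]

section Unital

variable (k : Type u) {B : Type u} [CommRing k] [LeftRegularBand B] [Finite B]

open MonoidAlgebra

/-- Given elements `e Y` with supports `Y`, the elements `f Y` of the semigroup algebra determined
by `f Y = e Y - ∑ e Y * f Z`, where `Z` runs over the supports below `Y`. -/
noncomputable def primitiveElement (e : SupportSemilattice B → B) :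
    SupportSemilattice B → MonoidAlgebra k B :=
  wellFounded_lt.fix fun Y f => single (e Y) 1 -
    ∑ᶠ Z : {Z // Z < Y}, single (e Y) 1 * f Z.1 Z.2

variable {k} {e : SupportSemilattice B → B}

theorem primitiveElement_eq (Y : SupportSemilattice B) : primitiveElement k e Y =
    single (e Y) 1 - ∑ᶠ Z : {Z // Z < Y}, single (e Y) 1 * primitiveElement k e Z.1 := by
  rw [primitiveElement, WellFounded.fix_eq]

-- This is the recursion for `f_Y` with `Y = support b`, multiplied on the left by `b` and
-- simplified by `b e_Y = b`.
open Classical in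
theorem single_eq_sum_primitiveElement (he : ∀ Y, support (e Y) = Y) [Fintype (SupportSemilattice B)]
    (b : B) : single b 1 = ∑ Z with Z ≤ support b, single b 1 * primitiveElement k e Z := by
  have h1 : (Finset.univ.filter fun Z => Z ≤ support b) =
      insert (support b) (Finset.univ.filter fun Z => Z < support b) := by
    ext Z
    simp [le_iff_eq_or_lt]
  have h2 : b * e (support b) = b := mul_eq_of_support_eq (he _).symm
  rw [h1, Finset.sum_insert (by simp)]
  rw [primitiveElement_eq (support b)]
  rw [mul_sub, single_mul_single, h2, one_mul, finsum_eq_sum_of_fintype, Finset.mul_sum]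
  simp_rw [← mul_assoc, single_mul_single, h2, one_mul]
  rw [Finset.sum_subtype (p := fun Z => Z < support b) _ (by simp)]
  abel

/-- If `Y` is not below the support of `b`, then `b e_Y` has support strictly below `Y`. Its
expansion in the `b e_Y f_Z` thus involves only `Z < Y`, and the other `Z < Y` contribute zero by
induction. Hence `b e_Y` equals the whole sum subtracted in `b f_Y`. -/
theorem single_mul_primitiveElement (he : ∀ Y, support (e Y) = Y) (Y : SupportSemilattice B) :
    ∀ b : B, ¬ Y ≤ support b → single b 1 * primitiveElement k e Y = 0 := by
  classical
  have := Fintype.ofFinite (SupportSemilattice B)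
  induction Y using WellFoundedLT.induction with
  | ind Y ih =>
    intro b hb
    have hle : support (b * e Y) ≤ Y := (support_mul_le_right b (e Y)).trans (he Y).le
    have hlt : support (b * e Y) < Y :=
      lt_of_le_of_ne hle fun h => hb (h.ge.trans (support_mul_le_left _ _))
    rw [primitiveElement_eq, mul_sub, single_mul_single, one_mul, finsum_eq_sum_of_fintype,
      Finset.mul_sum]
    simp_rw [← mul_assoc, single_mul_single, one_mul]
    rw [sub_eq_zero, ← Finset.sum_subtype (p := fun Z => Z < Y)
      (Finset.univ.filter fun Z => Z < Y) (by simp)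
      fun Z => single (b * e Y) (1 : k) * primitiveElement k e Z]
    conv_lhs => rw [single_eq_sum_primitiveElement he (b * e Y)]
    refine Finset.sum_subset (fun Z hZ => ?_) fun Z hZ hZ' => ?_
    · simp only [Finset.mem_filter, Finset.mem_univ, true_and] at hZ ⊢
      exact hZ.trans_lt hlt
    · simp only [Finset.mem_filter, Finset.mem_univ, true_and] at hZ hZ'
      exact ih Z hZ _ hZ'

theorem single_mul_sum_primitiveElement (he : ∀ Y, support (e Y) = Y)
    [Fintype (SupportSemilattice B)] (b : B) :
    single b 1 * ∑ Z, primitiveElement k e Z = single b 1 := by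
  classical
  conv_rhs => rw [single_eq_sum_primitiveElement he b]
  rw [Finset.mul_sum]
  symm
  refine Finset.sum_subset (Finset.subset_univ _) fun Z _ hZ => ?_
  simp only [Finset.mem_filter, Finset.mem_univ, true_and] at hZ
  exact single_mul_primitiveElement he Z b hZ

theorem primitiveElement_mul_single (he : ∀ Y, support (e Y) = Y) (Y : SupportSemilattice B) :
    ∀ b : B, Y ≤ support b → primitiveElement k e Y * single b 1 = primitiveElement k e Y := by
  have := Fintype.ofFinite (SupportSemilattice B)
  induction Y using WellFoundedLT.induction with
  | ind Y ih =>
    intro b hb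
    classical
    have h : e Y * b = e Y := support_le.1 ((he Y).le.trans hb)
    rw [primitiveElement_eq, sub_mul, single_mul_single, one_mul, h, finsum_eq_sum_of_fintype,
      Finset.sum_mul]
    congr 1
    refine Finset.sum_congr rfl fun Z _ => ?_
    rw [mul_assoc, ih Z.1 Z.2 b (Z.2.le.trans hb)]

theorem mul_sum_primitiveElement (he : ∀ Y, support (e Y) = Y)
    [Fintype (SupportSemilattice B)] (x : MonoidAlgebra k B) :
    x * ∑ Z, primitiveElement k e Z = x := by
  have := Fintype.ofFinite B
  rw [eq_sum_smul_single x, Finset.sum_mul]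
  refine Finset.sum_congr rfl fun b _ => ?_
  rw [smul_mul_assoc, single_mul_sum_primitiveElement he]

/-- If `B` is connected, then every right identity of the semigroup algebra is a left identity. -/
theorem mul_single_of_right_identity (hB : IsConnected B) {η : MonoidAlgebra k B}
    (hη : ∀ x, x * η = x) (V : SupportSemilattice B) :
    ∀ b v : B, support v = V → (η * single b 1 - single b 1).coeff v = 0 := by
  classical
  have := Fintype.ofFinite B
  -- Downward induction: at elements of support larger than `V`, all coefficients are already known
  -- to vanish.
  induction V using WellFoundedGT.induction with
  | ind V ih =>
    intro b v hv
    set D : B → MonoidAlgebra k B := fun b => η * single b 1 - single b 1 with hD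
    have hsub (x y : B) (hxy : x * y = y) : D y = D x * single y 1 := by
      simp only [hD, sub_mul, mul_assoc, single_mul_single, one_mul, hxy]
    have hzero (x : B) (hx : ¬ V ≤ support x) : (D x).coeff v = 0 := by
      rw [hsub x x (LeftRegularBand.mul_self x), coeff_mul_single_eq]
      refine Finset.sum_eq_zero fun a ha => (hx ?_).elim
      simp only [Finset.mem_filter, Finset.mem_univ, true_and] at ha
      rw [← hv, ← ha]
      exact support_mul_le_right a x
    have hle (x y : B) (hxy : y ≤ x) (hy : V ≤ support y) :
        (D y).coeff v = (D x).coeff v := by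
      rw [hsub x y hxy, coeff_mul_single_eq]
      refine Finset.sum_eq_single_of_mem v ?_ fun a ha hav => ?_
      · simp only [Finset.mem_filter, Finset.mem_univ, true_and]
        exact support_le.1 (hv.le.trans hy)
      · simp only [Finset.mem_filter, Finset.mem_univ, true_and] at ha
        -- Right multiplication by `y` can send to `v` only elements of support at least `V`. Those
        -- of larger support have coefficient zero by induction, and `y` fixes those of support `V`,
        -- which leaves only `v`.
        have hVa : V ≤ support a := by
          rw [← hv, ← ha]
          exact support_mul_le_left a y
        rcases hVa.eq_or_lt with h | h
        · exact (hav (by rw [← ha, support_le.1 (h.ge.trans hy)])).elim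
        · exact ih _ h _ _ rfl
    have hreach (x y : contraction V) : (D x.1).coeff v = (D y.1).coeff v := by
      obtain ⟨p⟩ := (hB V).preconnected x y
      induction p with
      | nil => rfl
      | @cons x y z h _ ih' =>
        rw [← ih']
        rcases h.2 with h | h
        · exact hle _ _ h x.2
        · exact (hle _ _ h y.2).symm
    by_cases hb : V ≤ support b
    swap
    · exact hzero b hb
    -- The character of `V` takes the value 1 at `v`, so applying it to `vη = v` shows that its
    -- value at `η` is 1.
    have hχ : MonoidAlgebra.liftMagma k (supportCharacter k V) η = 1 := by
      have h1 : MonoidAlgebra.liftMagma k (supportCharacter k V) (single v 1) = 1 := by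
        simp [supportCharacter, mem_contraction, hv]
      have h2 := congrArg (MonoidAlgebra.liftMagma k (supportCharacter k V)) (hη (single v 1))
      rwa [map_mul, h1, one_mul] at h2
    have hsum : ∑ a, η.coeff a • D a = 0 := by
      have h3 : ∑ a, η.coeff a • D a = η * η - η := by
        simp only [hD, smul_sub, Finset.sum_sub_distrib, ← mul_smul_comm, ← Finset.mul_sum]
        rw [← eq_sum_smul_single η]
      rw [h3, hη, sub_self]
    have hsum' := congrArg (fun x => x.coeff v) hsum
    rw [eq_sum_smul_single η, map_sum] at hχ
    simp only [coeff_sum, Finsupp.finsetSum_apply, coeff_smul, Finsupp.smul_apply,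
      coeff_zero, Finsupp.zero_apply] at hsum'
    -- Only `a` with `V ≤ support a` contribute, and for these the coefficient of `D a` does not
    -- depend on `a`; the weights add up to the character of `η`.
    have h4 : ∑ a, η.coeff a • (D a).coeff v =
        (∑ a, (liftMagma k (supportCharacter k V)) (η.coeff a • single a 1)) •
          (D b).coeff v := by
      rw [Finset.sum_smul]
      refine Finset.sum_congr rfl fun a _ => ?_
      by_cases ha : V ≤ support a
      · rw [hreach ⟨a, ha⟩ ⟨b, hb⟩]
        simp [supportCharacter, mem_contraction, ha]
      · rw [hzero a ha]
        simp [supportCharacter, mem_contraction, ha]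
    rw [h4, hχ, one_smul] at hsum'
    exact hsum'

theorem isUnital_of_isConnected (k : Type u) [CommRing k] (hB : IsConnected B) :
    IsUnital k B := by
  have := Fintype.ofFinite (SupportSemilattice B)
  have := Fintype.ofFinite B
  choose e he using exists_support_eq (B := B)
  have hr := mul_sum_primitiveElement (k := k) he
  refine ⟨⟨_, fun x => ⟨?_, hr x⟩⟩⟩
  conv_lhs => rw [eq_sum_smul_single x, Finset.mul_sum]
  conv_rhs => rw [eq_sum_smul_single x]
  refine Finset.sum_congr rfl fun b _ => ?_
  rw [mul_smul_comm]
  congr 1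
  rw [← sub_eq_zero]
  ext v
  exact mul_single_of_right_identity hB hr _ b v rfl

end Unital

end LRB

/-! ### Simplicial chains of posets: degenerate tuples, functoriality and cones. -/

namespace LRB

/-! ### Appending a last element to a tuple -/

section AppendLast

variable {P : Type u}

/-- The tuple obtained by appending a last element. -/
abbrev appendLast {m : ℕ} (t : Fin m → P) (b : P) : Fin (m + 1) → P :=
  Fin.snoc (α := fun _ => P) t b

theorem appendLast_mem {S : Set P} {m : ℕ} {t : Fin m → P} {b : P} (ht : ∀ i, t i ∈ S) (hb : b ∈ S)
    (i : Fin (m + 1)) : appendLast t b i ∈ S := by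
  induction i using Fin.lastCases with
  | last => simpa using hb
  | cast i => simpa using ht i

theorem appendLast_castSucc_succAbove {m : ℕ} (t : Fin (m + 1) → P) (b : P) (i : Fin (m + 1)) :
    (fun j => appendLast t b (i.castSucc.succAbove j)) =
      appendLast (fun j => t (i.succAbove j)) b := by
  funext j
  induction j using Fin.lastCases with
  | last => simp [appendLast]
  | cast j => simp [appendLast, Fin.castSucc_succAbove_castSucc]

theorem appendLast_last_succAbove {m : ℕ} (t : Fin m → P) (b : P) :
    (fun j => appendLast t b ((Fin.last m).succAbove j)) = t := by
  funext j
  simp [appendLast]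

end AppendLast

/-! ### Simplicial chains of order complexes -/

section SimplicialChains

variable {P : Type u} [PartialOrder P]

theorem strictMono_of_monotone {m : ℕ} {t : Fin (m + 1) → P} (ht : Monotone t)
    (h : ∀ i : Fin m, t i.castSucc ≠ t i.succ) : StrictMono t :=
  Fin.strictMono_iff_lt_succ.2 fun i => lt_of_le_of_ne (ht (Fin.castSucc_lt_succ).le) (h i)

variable (k : Type u) [CommRing k] (S : Set P)

open Classical in
/-- The value at an `m`-tuple `t` of a function `f` on chains, extended by zero to the tuples
which are not chains in `S`. -/
noncomputable def extendChain {M : Type*} [Zero M] {m : ℕ} (f : Chain S m → M)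
    (t : Fin m → P) : M :=
  if h : StrictMono t ∧ ∀ i, t i ∈ S then f ⟨t, h⟩ else 0

variable {k S}

theorem extendChain_coe {M : Type*} [Zero M] {m : ℕ} (f : Chain S m → M) (s : Chain S m) :
    extendChain S f s.1 = f s := by
  rw [extendChain, dif_pos s.2]

theorem extendChain_of_mem {M : Type*} [Zero M] {m : ℕ} (f : Chain S m → M) {t : Fin m → P}
    (h : StrictMono t ∧ ∀ i, t i ∈ S) : extendChain S f t = f ⟨t, h⟩ := by
  rw [extendChain, dif_pos h]

theorem extendChain_of_not {M : Type*} [Zero M] {m : ℕ} (f : Chain S m → M) {t : Fin m → P}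
    (h : ¬ (StrictMono t ∧ ∀ i, t i ∈ S)) : extendChain S f t = 0 := by
  rw [extendChain, dif_neg h]

theorem map_extendChain {F M N : Type*} [Zero M] [Zero N] [FunLike F M N] [ZeroHomClass F M N]
    (φ : F) {m : ℕ} (f : Chain S m → M) (t : Fin m → P) :
    φ (extendChain S f t) = extendChain S (fun s => φ (f s)) t := by
  unfold extendChain
  split_ifs
  · rfl
  · exact map_zero φ

/-- The alternating sum of the faces of a degenerate tuple vanishes. -/
theorem sum_faces_of_not_strictMono {M : Type*} [AddCommGroup M] {m : ℕ} (f : Chain S m → M)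
    {t : Fin (m + 1) → P} (ht : Monotone t) (h : ¬ StrictMono t) :
    ∑ i : Fin (m + 1), (-1 : ℤ) ^ (i : ℕ) • extendChain S f (fun j => t (i.succAbove j)) = 0 := by
  obtain ⟨j, hj⟩ : ∃ j : Fin m, t j.castSucc = t j.succ := by
    by_contra! hne
    exact h (strictMono_of_monotone ht hne)
  have hne : j.castSucc ≠ j.succ := (Fin.castSucc_lt_succ).ne
  -- Omitting either of the two equal neighbours gives the same face, with opposite signs; every
  -- other face still contains both and is degenerate.
  rw [Finset.sum_eq_add_of_mem j.castSucc j.succ (Finset.mem_univ _) (Finset.mem_univ _) hne]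
  · have hface : (fun l => t (j.castSucc.succAbove l)) = fun l => t (j.succ.succAbove l) := by
      funext l
      rcases lt_trichotomy l j with hl | rfl | hl
      · rw [Fin.succAbove_of_castSucc_lt _ _ (by simpa using hl),
          Fin.succAbove_of_castSucc_lt _ _ (by simpa [Fin.lt_def] using Nat.lt_succ_of_lt hl)]
      · rw [Fin.succAbove_castSucc_self, Fin.succAbove_succ_self, hj]
      · rw [Fin.succAbove_of_le_castSucc _ _ (by simpa using hl.le),
          Fin.succAbove_of_le_castSucc _ _ (by simpa [Fin.le_def] using hl)]
    rw [hface, ← add_smul]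
    simp [pow_succ]
  · rintro i - ⟨hi, hi'⟩
    rw [extendChain_of_not, smul_zero]
    rintro ⟨hs, -⟩
    obtain ⟨a, ha⟩ := Fin.exists_succAbove_eq hi.symm
    obtain ⟨b, hb⟩ := Fin.exists_succAbove_eq hi'.symm
    have hab : a ≠ b := by
      rintro rfl
      exact hne (ha.symm.trans hb)
    refine hab (hs.injective ?_)
    simp only [ha, hb, hj]

variable (k S) in
/-- The module of simplicial chains of the order complex `Δ(S)`, spanned by the chains with `m`
elements. -/
abbrev SimplicialChains (m : ℕ) : Type u := Chain S m →₀ k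

variable (k S) in
/-- The simplicial chain given by an `m`-tuple; zero if the tuple is not a chain in `S`. -/
noncomputable def simplex {m : ℕ} (t : Fin m → P) : SimplicialChains k S m :=
  extendChain S (fun s => Finsupp.single s 1) t

theorem simplex_coe {m : ℕ} (s : Chain S m) : simplex k S s.1 = Finsupp.single s 1 :=
  extendChain_coe _ s

/-- The linear extension of a function on chains. -/
theorem linearCombination_simplex {M : Type*} [AddCommGroup M] [Module k M] {m : ℕ}
    (f : Chain S m → M) (t : Fin m → P) :
    Finsupp.linearCombination k f (simplex k S t) = extendChain S f t := by
  rw [simplex, map_extendChain]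
  simp

variable (k S) in
/-- The simplicial boundary. -/
noncomputable def boundary (m : ℕ) : SimplicialChains k S (m + 1) →ₗ[k] SimplicialChains k S m :=
  Finsupp.linearCombination k fun s =>
    ∑ i : Fin (m + 1), (-1 : ℤ) ^ (i : ℕ) • simplex k S fun j => s.1 (i.succAbove j)

/-- Monotone tuples are allowed because left multiplication may identify elements of a chain. A
degenerate tuple gives zero on both sides. -/
theorem boundary_simplex {m : ℕ} {t : Fin (m + 1) → P} (ht : Monotone t) (hS : ∀ i, t i ∈ S) :
    boundary k S m (simplex k S t) =
      ∑ i : Fin (m + 1), (-1 : ℤ) ^ (i : ℕ) • simplex k S fun j => t (i.succAbove j) := by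
  rw [boundary, linearCombination_simplex]
  by_cases h : StrictMono t
  · rw [extendChain_of_mem _ ⟨h, hS⟩]
  · rw [extendChain_of_not _ (fun h' => h h'.1)]
    exact (sum_faces_of_not_strictMono _ ht h).symm

/-- The boundary is dual to the coboundary, so `∂∂ = 0` can be deduced from `δδ = 0` by evaluating
coordinate functions. -/
theorem linearCombination_boundary {m : ℕ} (f : Chain S m → k) (x : SimplicialChains k S (m + 1)) :
    Finsupp.linearCombination k f (boundary k S m x) =
      Finsupp.linearCombination k (coboundary k S m f) x := by
  suffices h : (Finsupp.linearCombination k f).comp (boundary k S m) =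
      Finsupp.linearCombination k (coboundary k S m f) from LinearMap.congr_fun h x
  refine Finsupp.lhom_ext' fun s => LinearMap.ext_ring ?_
  simp only [LinearMap.comp_apply, Finsupp.lsingle_apply]
  rw [← simplex_coe, boundary_simplex s.2.1.monotone s.2.2, map_sum, linearCombination_simplex,
    extendChain_coe]
  refine Finset.sum_congr rfl fun i _ => ?_
  rw [map_zsmul, linearCombination_simplex]
  have h := extendChain_coe f (s.face i)
  rw [← h, zsmul_eq_mul]
  simp [Chain.face]

theorem boundary_boundary (m : ℕ) (x : SimplicialChains k S (m + 2)) :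
    boundary k S m (boundary k S (m + 1) x) = 0 := by
  classical
  ext s
  have h (y : SimplicialChains k S m) :
      y s = Finsupp.linearCombination k (Pi.single s (1 : k)) y := by
    simp [Finsupp.linearCombination_apply, Finsupp.sum, Pi.single_apply]
  rw [h, linearCombination_boundary, linearCombination_boundary, ← LinearMap.comp_apply,
    coboundary_coboundary]
  simp

theorem simplicialChains_ext {M : Type*} [AddCommGroup M] [Module k M] {m : ℕ}
    {f g : SimplicialChains k S m →ₗ[k] M} (h : ∀ s : Chain S m, f (simplex k S s.1) = g (simplex k S s.1)) :
    f = g := by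
  refine Finsupp.lhom_ext' fun s => LinearMap.ext_ring ?_
  simpa [simplex_coe] using h s

variable (k S) in
/-- The map on simplicial chains induced by a map of posets. -/
noncomputable def mapChains (g : P → P) (m : ℕ) :
    SimplicialChains k S m →ₗ[k] SimplicialChains k S m :=
  Finsupp.linearCombination k fun s => simplex k S (g ∘ s.1)

theorem mapChains_simplex {g : P → P} {m : ℕ}
    {t : Fin m → P} (ht : Monotone t) (hS : ∀ i, t i ∈ S) :
    mapChains k S g m (simplex k S t) = simplex k S (g ∘ t) := by
  rw [mapChains, linearCombination_simplex]
  by_cases h : StrictMono t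
  · rw [extendChain_of_mem _ ⟨h, hS⟩]
  · rw [extendChain_of_not _ (fun h' => h h'.1), simplex, extendChain_of_not]
    rintro ⟨h', -⟩
    exact h (ht.strictMono_of_injective (Function.Injective.of_comp h'.injective))

theorem mapChains_boundary {g : P → P} (hg : ∀ x ∈ S, g x ∈ S) (hm : Monotone g) {m : ℕ}
    (x : SimplicialChains k S (m + 1)) :
    mapChains k S g m (boundary k S m x) = boundary k S m (mapChains k S g (m + 1) x) := by
  suffices h : (mapChains k S g m).comp (boundary k S m) =
      (boundary k S m).comp (mapChains k S g (m + 1)) from LinearMap.congr_fun h x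
  refine simplicialChains_ext fun s => ?_
  have hs := s.2.1.monotone
  rw [LinearMap.comp_apply, LinearMap.comp_apply, mapChains_simplex hs s.2.2,
    boundary_simplex hs s.2.2, boundary_simplex (hm.comp hs) fun i => hg _ (s.2.2 i), map_sum]
  refine Finset.sum_congr rfl fun i _ => ?_
  rw [map_zsmul, mapChains_simplex (t := fun j => s.1 (i.succAbove j))
    (hs.comp (Fin.strictMono_succAbove i).monotone) fun j => s.2.2 _]
  rfl

/-! ### Cones -/

theorem appendLast_monotone {m : ℕ} {t : Fin m → P} {b : P} (ht : Monotone t)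
    (hb : ∀ i, t i ≤ b) : Monotone (appendLast t b) := by
  intro i j hij
  induction j using Fin.lastCases with
  | last =>
    induction i using Fin.lastCases with
    | last => simp
    | cast i => simpa using hb i
  | cast j =>
    induction i using Fin.lastCases with
    | last => exact absurd hij (not_le.2 (Fin.castSucc_lt_last j))
    | cast i => simpa using ht (by simpa using hij)

theorem appendLast_strictMono {m : ℕ} {t : Fin m → P} {b : P} (ht : StrictMono t)
    (hb : ∀ i, t i < b) : StrictMono (appendLast t b) := by
  intro i j hij
  induction j using Fin.lastCases with
  | last =>
    induction i using Fin.lastCases with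
    | last => simp at hij
    | cast i => simpa using hb i
  | cast j =>
    induction i using Fin.lastCases with
    | last => exact absurd hij (not_lt.2 (Fin.castSucc_lt_last j).le)
    | cast i => simpa using ht (by simpa using hij)

variable (k S) in
/-- The cone over the map on simplicial chains induced by a map of posets bounded by `b`. -/
noncomputable def cone (g : P → P) (b : P) (m : ℕ) :
    SimplicialChains k S m →ₗ[k] SimplicialChains k S (m + 1) :=
  Finsupp.linearCombination k fun s => simplex k S (appendLast (g ∘ s.1) b)

theorem cone_simplex {g : P → P} (b : P) {m : ℕ}
    {t : Fin m → P} (ht : Monotone t) (hS : ∀ i, t i ∈ S) :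
    cone k S g b m (simplex k S t) = simplex k S (appendLast (g ∘ t) b) := by
  rw [cone, linearCombination_simplex]
  by_cases h : StrictMono t
  · rw [extendChain_of_mem _ ⟨h, hS⟩]
  · rw [extendChain_of_not _ (fun h' => h h'.1), simplex, extendChain_of_not]
    rintro ⟨h', -⟩
    refine h (ht.strictMono_of_injective (Function.Injective.of_comp (f := g) fun i j hij => ?_))
    have hij' : appendLast (g ∘ t) b i.castSucc = appendLast (g ∘ t) b j.castSucc := by
      simpa using hij
    simpa using h'.injective hij'

/-- The cone is a null-homotopy, up to sign, of the map on simplicial chains. -/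
theorem boundary_cone {g : P → P} (hg : ∀ x ∈ S, g x ∈ S) (hm : Monotone g) {b : P} (hb : b ∈ S)
    (hgb : ∀ x ∈ S, g x ≤ b) {m : ℕ} (x : SimplicialChains k S (m + 1)) :
    boundary k S (m + 1) (cone k S g b (m + 1) x) =
      cone k S g b m (boundary k S m x) + (-1 : ℤ) ^ (m + 1) • mapChains k S g (m + 1) x := by
  suffices h : (boundary k S (m + 1)).comp (cone k S g b (m + 1)) =
      (cone k S g b m).comp (boundary k S m) + (-1 : ℤ) ^ (m + 1) • mapChains k S g (m + 1) from
    LinearMap.congr_fun h x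
  refine simplicialChains_ext fun s => ?_
  have hs := s.2.1.monotone
  rw [LinearMap.add_apply, LinearMap.smul_apply, LinearMap.comp_apply, LinearMap.comp_apply,
    mapChains_simplex hs s.2.2, cone_simplex b hs s.2.2,
    boundary_simplex (appendLast_monotone (hm.comp hs) fun i => hgb _ (s.2.2 i))
      (appendLast_mem (fun i => hg _ (s.2.2 i)) hb), boundary_simplex hs s.2.2, map_sum,
    Fin.sum_univ_castSucc, appendLast_last_succAbove]
  refine congrArg₂ _ (Finset.sum_congr rfl fun i _ => ?_) (by simp)
  rw [appendLast_castSucc_succAbove, map_zsmul,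
    cone_simplex (t := fun j => s.1 (i.succAbove j)) b
      (hs.comp (Fin.strictMono_succAbove i).monotone) fun j => s.2.2 _]
  rfl

theorem boundary_cone_zero {g : P → P} {b : P} (hb : b ∈ S) (x : SimplicialChains k S 0) :
    boundary k S 0 (cone k S g b 0 x) = mapChains k S g 0 x := by
  suffices h : (boundary k S 0).comp (cone k S g b 0) = mapChains k S g 0 from
    LinearMap.congr_fun h x
  refine simplicialChains_ext fun s => ?_
  have hs := s.2.1.monotone
  rw [LinearMap.comp_apply, cone_simplex b hs s.2.2,
    boundary_simplex (appendLast_monotone (fun i => i.elim0) fun i => i.elim0)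
      (appendLast_mem (fun i => i.elim0) hb), mapChains, linearCombination_simplex,
      extendChain_coe]
  rw [Fin.sum_univ_one, Fin.val_zero, pow_zero, one_smul]
  congr 1
  funext i
  exact i.elim0

end SimplicialChains

end LRB

/-! ### The chains of a contraction as an exact complex of projective modules. -/

namespace LRB

open MonoidAlgebra

/-! ### Modules over the semigroup algebra -/

section Modules

variable {k B : Type u} [CommRing k] [LeftRegularBand B] [IsUnital k B]

theorem algebra_smul_def (r : k) (x : MonoidAlgebra k B) :
    algebraMap k (MonoidAlgebra k B) r * x = r • x :=
  (Algebra.smul_def r x).symm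

/-- An additive map between modules over the semigroup algebra which is `k`-linear and commutes
with the action of the semigroup is linear. -/
noncomputable def linearMapOfEquivariant {M N : Type*} [AddCommGroup M] [AddCommGroup N]
    [Module k M] [Module (MonoidAlgebra k B) M] [IsScalarTower k (MonoidAlgebra k B) M]
    [Module k N] [Module (MonoidAlgebra k B) N] [IsScalarTower k (MonoidAlgebra k B) N]
    (f : M →ₗ[k] N) (hf : ∀ (b : B) (x : M),
      f (single b (1 : k) • x) = single b (1 : k) • f x) :
    M →ₗ[MonoidAlgebra k B] N where
  toFun := f
  map_add' := map_add f
  map_smul' a x := by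
    induction a using MonoidAlgebra.induction_linear with
    | zero => simp
    | add a b ha hb =>
      simp only [RingHom.id_apply] at ha hb ⊢
      rw [add_smul, add_smul, map_add, ha, hb]
    | single b r =>
      have h : single b r = r • single b (1 : k) := by simp
      simp only [RingHom.id_apply]
      rw [h, smul_assoc, smul_assoc, map_smul, hf]

/-- The ring homomorphism from the semigroup algebra given by a linear action of the semigroup. -/
noncomputable def actionRingHom {M : Type*} [AddCommGroup M] [Module k M]
    (ρ : B →ₙ* Module.End k M) (hρ : Submodule.span k {x : M | ∃ b y, ρ b y = x} = ⊤) :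
    MonoidAlgebra k B →+* Module.End k M :=
  let φ := MonoidAlgebra.liftMagma k ρ
  { toFun := φ
    map_zero' := map_zero φ
    map_add' := map_add φ
    map_mul' := map_mul φ
    map_one' := by
      -- The relation `1 · b = b` shows that the identity of `kB` fixes the image of every `ρ b`,
      -- and these images span.
      refine LinearMap.ext_on hρ ?_
      rintro _ ⟨b, y, rfl⟩
      have h : φ (single b 1) = ρ b := by simp [φ]
      rw [← h, ← Module.End.mul_apply, ← map_mul, one_mul, Module.End.one_apply] }

theorem actionRingHom_single {M : Type*} [AddCommGroup M] [Module k M]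
    (ρ : B →ₙ* Module.End k M) (hρ : Submodule.span k {x : M | ∃ b y, ρ b y = x} = ⊤)
    (b : B) (r : k) : actionRingHom ρ hρ (single b r) = r • ρ b := by
  change MonoidAlgebra.liftMagma k ρ (single b r) = _
  simp

theorem actionRingHom_smul {M : Type*} [AddCommGroup M] [Module k M]
    (ρ : B →ₙ* Module.End k M) (hρ : Submodule.span k {x : M | ∃ b y, ρ b y = x} = ⊤)
    (r : k) (a : MonoidAlgebra k B) :
    actionRingHom ρ hρ (r • a) = r • actionRingHom ρ hρ a :=
  map_smul (MonoidAlgebra.liftMagma k ρ) r a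

open Classical in
theorem supportRingHom_single (X : SupportSemilattice B) (b : B) (r : k) :
    supportRingHom k X (single b r) = if X ≤ support b then r else 0 := by
  change MonoidAlgebra.liftMagma k (supportCharacter k X) (single b r) = _
  simp [supportCharacter, mem_contraction]

theorem supportRingHom_smul (X : SupportSemilattice B) (r : k) (a : MonoidAlgebra k B) :
    supportRingHom k X (r • a) = r * supportRingHom k X a :=
  map_smul (MonoidAlgebra.liftMagma k (supportCharacter k X)) r a

/-- The module over the semigroup algebra with underlying `k`-module `V` on which `b` acts as
the identity if `X ≤ support b`, and as zero otherwise. -/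
def Isotypic (_X : SupportSemilattice B) (V : Type*) : Type _ := V

section Isotypic

variable (X : SupportSemilattice B) (V : Type*) [AddCommGroup V] [Module k V]

instance : AddCommGroup (Isotypic X V) := inferInstanceAs (AddCommGroup V)

instance : Module k (Isotypic X V) := inferInstanceAs (Module k V)

noncomputable instance : Module (MonoidAlgebra k B) (Isotypic X V) :=
  Module.compHom V (supportRingHom k X)

variable {X V}

theorem isotypic_smul_def (a : MonoidAlgebra k B) (v : Isotypic X V) :
    a • v = supportRingHom k X a • v := rfl

instance : IsScalarTower k (MonoidAlgebra k B) (Isotypic X V) where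
  smul_assoc r a v := by
    rw [isotypic_smul_def, isotypic_smul_def, supportRingHom_smul, mul_smul]

theorem single_smul_isotypic_of_le {b : B} (h : X ≤ support b) (v : Isotypic X V) :
    single b (1 : k) • v = v := by
  rw [isotypic_smul_def, supportRingHom_single, if_pos h, one_smul]

theorem single_smul_isotypic_of_not {b : B} (h : ¬ X ≤ support b) (v : Isotypic X V) :
    single b (1 : k) • v = 0 := by
  rw [isotypic_smul_def, supportRingHom_single, if_neg h, zero_smul]

theorem supportModule_eq (X : SupportSemilattice B) :
    supportModule k X = ModuleCat.of (MonoidAlgebra k B) (Isotypic X k) := rfl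

end Isotypic

end Modules

/-! ### Simplicial chains of contractions as modules over the semigroup algebra -/

section ChainModules

variable {k B : Type u} [CommRing k] [LeftRegularBand B]

theorem mul_mem_contraction {X : SupportSemilattice B} {b : B} (hb : b ∈ contraction X) :
    ∀ x ∈ contraction X, b * x ∈ contraction X :=
  fun _ hx => le_support_mul.2 ⟨hb, hx⟩

variable (k) in
open Classical in
/-- The action of a left regular band on the simplicial chains of a contraction. -/
noncomputable def chainAction (X : SupportSemilattice B) (m : ℕ) :
    B →ₙ* Module.End k (SimplicialChains k (contraction X) m) where
  toFun b := if b ∈ contraction X then mapChains k (contraction X) (b * ·) m else 0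
  map_mul' a b := by
    by_cases ha : a ∈ contraction X
    swap
    · rw [if_neg ha, if_neg fun h => ha ((mul_mem_contraction_iff X a b).1 h).1, zero_mul]
    by_cases hb : b ∈ contraction X
    swap
    · rw [if_neg hb, if_neg fun h => hb ((mul_mem_contraction_iff X a b).1 h).2, mul_zero]
    rw [if_pos ha, if_pos hb, if_pos ((mul_mem_contraction_iff X a b).2 ⟨ha, hb⟩)]
    refine simplicialChains_ext fun s => ?_
    rw [Module.End.mul_apply, mapChains_simplex s.2.1.monotone s.2.2,
      mapChains_simplex s.2.1.monotone s.2.2,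
      mapChains_simplex ((mul_monotone b).comp s.2.1.monotone)
        fun i => mul_mem_contraction hb _ (s.2.2 i)]
    congr 1
    funext i
    exact mul_assoc a b _

theorem chainAction_of_mem {X : SupportSemilattice B} {b : B} (h : X ≤ support b) {m : ℕ}
    {t : Fin m → B} (ht : Monotone t) (hX : ∀ i, X ≤ support (t i)) :
    chainAction k X m b (simplex k (contraction X) t) =
      simplex k (contraction X) fun i => b * t i := by
  have h' : chainAction k X m b = mapChains k (contraction X) (b * ·) m := if_pos h
  rw [h', mapChains_simplex ht hX]
  rfl

theorem chainAction_of_not {X : SupportSemilattice B} {b : B} (h : ¬ X ≤ support b) (m : ℕ) :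
    chainAction k X m b = 0 := if_neg h

theorem last_mul_eq {m : ℕ} {t : Fin (m + 1) → B} (ht : Monotone t) (i : Fin (m + 1)) :
    t (Fin.last m) * t i = t i :=
  ht (Fin.le_last i)

/-- The top element of a nonempty chain fixes the chain, and any element of support `X` fixes the
empty one. This is what makes the action of `kB` unitary. -/
theorem span_chainAction (X : SupportSemilattice B) (m : ℕ) : Submodule.span k
    {x : SimplicialChains k (contraction X) m | ∃ b y, chainAction k X m b y = x} = ⊤ := by
  refine eq_top_iff.2 fun x _ => ?_
  induction x using Finsupp.induction_linear with
  | zero => exact zero_mem _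
  | add x y hx hy => exact add_mem (hx trivial) (hy trivial)
  | single s r =>
    rw [← mul_one r, ← smul_eq_mul, ← Finsupp.smul_single, ← simplex_coe]
    refine Submodule.smul_mem _ _ (Submodule.subset_span ?_)
    cases m with
    | zero =>
      obtain ⟨b, hb⟩ := exists_support_eq X
      refine ⟨b, simplex k _ s.1, ?_⟩
      rw [chainAction_of_mem hb.ge s.2.1.monotone s.2.2]
      congr 1
      funext i
      exact i.elim0
    | succ m =>
      refine ⟨s.1 (Fin.last m), simplex k _ s.1, ?_⟩
      rw [chainAction_of_mem (s.2.2 _) s.2.1.monotone s.2.2]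
      congr 1
      funext i
      exact last_mul_eq s.2.1.monotone i

variable [IsUnital k B]

noncomputable instance chainModule (X : SupportSemilattice B) (m : ℕ) :
    Module (MonoidAlgebra k B) (SimplicialChains k (contraction X) m) :=
  Module.compHom _ (actionRingHom (chainAction k X m) (span_chainAction X m))

theorem single_smul_chain {X : SupportSemilattice B} {m : ℕ} (b : B)
    (x : SimplicialChains k (contraction X) m) :
    single b (1 : k) • x = chainAction k X m b x := by
  change actionRingHom (chainAction k X m) (span_chainAction X m) (single b 1) x = _
  rw [actionRingHom_single, one_smul]

instance (X : SupportSemilattice B) (m : ℕ) :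
    IsScalarTower k (MonoidAlgebra k B) (SimplicialChains k (contraction X) m) where
  smul_assoc r a x := by
    change actionRingHom (chainAction k X m) (span_chainAction X m) (r • a) x = _
    rw [actionRingHom_smul]
    rfl

theorem single_smul_simplex_of_le {X : SupportSemilattice B} {b : B} (h : X ≤ support b) {m : ℕ}
    {t : Fin m → B} (ht : Monotone t) (hX : ∀ i, X ≤ support (t i)) :
    single b (1 : k) • simplex k (contraction X) t =
      simplex k (contraction X) fun i => b * t i := by
  rw [single_smul_chain, chainAction_of_mem h ht hX]

theorem single_smul_chain_of_not {X : SupportSemilattice B} {b : B} (h : ¬ X ≤ support b) {m : ℕ}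
    (x : SimplicialChains k (contraction X) m) : single b (1 : k) • x = 0 := by
  rw [single_smul_chain, chainAction_of_not h, LinearMap.zero_apply]

/-- The simplicial boundary as a map of modules over the semigroup algebra. -/
noncomputable def boundaryHom (X : SupportSemilattice B) (m : ℕ) :
    SimplicialChains k (contraction X) (m + 1) →ₗ[MonoidAlgebra k B]
      SimplicialChains k (contraction X) m :=
  linearMapOfEquivariant (boundary k (contraction X) m) fun b x => by
    by_cases h : X ≤ support b
    · have h' (m : ℕ) : chainAction k X m b = mapChains k (contraction X) (b * ·) m := if_pos h
      rw [single_smul_chain, single_smul_chain, h', h',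
        mapChains_boundary (mul_mem_contraction h) (mul_monotone b)]
    · rw [single_smul_chain_of_not h, single_smul_chain_of_not h, map_zero]

theorem eq_sum_smul_chain [Fintype B] {X : SupportSemilattice B} {m : ℕ}
    (x : SimplicialChains k (contraction X) m) :
    x = ∑ b, (1 : MonoidAlgebra k B).coeff b • single b (1 : k) • x := by
  have h := congrArg (· • x) (eq_sum_smul_single (1 : MonoidAlgebra k B))
  simp only [one_smul, Finset.sum_smul, smul_assoc] at h
  exact h

/-- The identity of `kB` writes a cycle `x` as a combination of the `b • x`. Each of these is a
boundary, up to sign of the cone over `bx` with apex `b`. Acyclicity thus follows from the existence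
of the identity alone. -/
theorem exists_boundary_eq [Finite B] {X : SupportSemilattice B} {m : ℕ}
    (x : SimplicialChains k (contraction X) (m + 1)) (hx : boundary k (contraction X) m x = 0) :
    ∃ y, boundary k (contraction X) (m + 1) y = x := by
  have := Fintype.ofFinite B
  rw [← LinearMap.mem_range, eq_sum_smul_chain x]
  refine Submodule.sum_mem _ fun b _ => Submodule.smul_mem _ _ ?_
  by_cases h : X ≤ support b
  · have h1 := boundary_cone (k := k) (S := contraction X) (g := (b * ·))
      (mul_mem_contraction h) (mul_monotone b) h (fun x _ => mul_le_left b x) x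
    have h' : chainAction k X (m + 1) b = mapChains k (contraction X) (b * ·) (m + 1) := if_pos h
    rw [hx, map_zero, zero_add, ← h', ← single_smul_chain] at h1
    refine ⟨(-1 : ℤ) ^ (m + 1) • cone k (contraction X) (b * ·) b (m + 1) x, ?_⟩
    rw [map_zsmul, h1, smul_smul, ← mul_pow]
    simp
  · rw [single_smul_chain_of_not h]
    exact zero_mem _

theorem boundary_zero_surjective [Finite B] (X : SupportSemilattice B) :
    Function.Surjective (boundary k (contraction X) 0) := by
  intro x
  have := Fintype.ofFinite B
  rw [← LinearMap.mem_range, eq_sum_smul_chain x]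
  refine Submodule.sum_mem _ fun b _ => Submodule.smul_mem _ _ ?_
  by_cases h : X ≤ support b
  · have h1 := boundary_cone_zero (k := k) (S := contraction X) (g := (b * ·)) h x
    have h' : chainAction k X 0 b = mapChains k (contraction X) (b * ·) 0 := if_pos h
    rw [← h', ← single_smul_chain] at h1
    exact ⟨_, h1⟩
  · rw [single_smul_chain_of_not h]
    exact zero_mem _

/-! ### Projectivity of the modules of chains -/

variable (k) in
/-- A basis element of the free module on the chains of a contraction; zero if the given tuple is
not a chain. -/
noncomputable def freeSimplex (X : SupportSemilattice B) {m : ℕ} (t : Fin m → B) :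
    Chain (contraction X) m →₀ MonoidAlgebra k B :=
  extendChain (contraction X) (fun s => Finsupp.single s 1) t

/-- The free module on chains maps onto the chain module. A splitting sends a chain `t` with top
element `t_m` to `∑_Z t_m f_Z [e_Z t]`. It is equivariant since `b t_m f_Z = 0` unless `Z ≤ support
b`, in which case `e_Z b = e_Z`. It is a section since `f_Z e_Z = f_Z` and `∑ f_Z` is a right
identity. A top element is needed, so the chains are nonempty. -/
theorem projective_chains [Finite B] (X : SupportSemilattice B) (m : ℕ) :
    Module.Projective (MonoidAlgebra k B) (SimplicialChains k (contraction X) (m + 1)) := by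
  have := Fintype.ofFinite (SupportSemilattice B)
  choose e he using exists_support_eq (B := B)
  let F := Chain (contraction X) (m + 1) →₀ MonoidAlgebra k B
  let σ₀ (t : Fin (m + 1) → B) : F := ∑ Z, (single (t (Fin.last m)) (1 : k) *
    primitiveElement k e Z) • freeSimplex k X fun i => e Z * t i
  have hσ₀ (t : Fin (m + 1) → B) (ht : Monotone t) (h : ¬ StrictMono t) : σ₀ t = 0 := by
    refine Finset.sum_eq_zero fun Z _ => ?_
    rw [freeSimplex, extendChain_of_not, smul_zero]
    rintro ⟨h', -⟩
    exact h (ht.strictMono_of_injective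
      (Function.Injective.of_comp (f := fun x => e Z * x) h'.injective))
  let σ₁ : SimplicialChains k (contraction X) (m + 1) →ₗ[k] F :=
    Finsupp.linearCombination k fun s => σ₀ s.1
  have hσ₁ (t : Fin (m + 1) → B) (ht : Monotone t) (hX : ∀ i, X ≤ support (t i)) :
      σ₁ (simplex k (contraction X) t) = σ₀ t := by
    simp only [σ₁]
    rw [linearCombination_simplex]
    by_cases h : StrictMono t
    · rw [extendChain_of_mem _ ⟨h, hX⟩]
    · rw [extendChain_of_not _ (fun h' => h h'.1), hσ₀ t ht h]
  have hequiv (b : B) : σ₁.comp (chainAction k X (m + 1) b) =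
      (DistribSMul.toLinearMap k F (single b (1 : k))).comp σ₁ := by
    refine simplicialChains_ext fun s => ?_
    have hs := s.2.1.monotone
    rw [LinearMap.comp_apply, LinearMap.comp_apply, hσ₁ _ hs s.2.2,
      DistribSMul.toLinearMap_apply, Finset.smul_sum]
    simp_rw [smul_smul, ← mul_assoc, single_mul_single, one_mul]
    by_cases h : X ≤ support b
    · rw [chainAction_of_mem h hs s.2.2, hσ₁ (fun i => b * s.1 i) ((mul_monotone b).comp hs)
        fun i => le_support_mul.2 ⟨h, s.2.2 i⟩]
      refine Finset.sum_congr rfl fun Z _ => ?_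
      by_cases hZ : Z ≤ support b
      · congr 2
        funext i
        rw [← mul_assoc, support_le.1 ((he Z).le.trans hZ)]
      · rw [single_mul_primitiveElement he Z _ fun h' => hZ (le_support_mul.1 h').1, zero_smul,
          zero_smul]
    · rw [chainAction_of_not h, LinearMap.zero_apply, map_zero]
      symm
      -- Here `b` acts by zero. If `Z ≤ support b`, then `X ≤ Z` fails, so `e_Z t` leaves the
      -- contraction; otherwise the coefficient vanishes.
      refine Finset.sum_eq_zero fun Z _ => ?_
      by_cases hZ : Z ≤ support b
      · rw [freeSimplex, extendChain_of_not, smul_zero]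
        rintro ⟨-, h'⟩
        refine h ?_
        have h2 : X ≤ support (e Z * s.1 (Fin.last m)) := h' (Fin.last m)
        exact (le_support_mul.1 h2).1.trans ((he Z).le.trans hZ)
      · rw [single_mul_primitiveElement he Z _ fun h' => hZ (le_support_mul.1 h').1, zero_smul]
  let σ : SimplicialChains k (contraction X) (m + 1) →ₗ[MonoidAlgebra k B] F :=
    linearMapOfEquivariant σ₁ fun b x => by
      rw [single_smul_chain]
      exact LinearMap.congr_fun (hequiv b) x
  let π : F →ₗ[MonoidAlgebra k B] SimplicialChains k (contraction X) (m + 1) :=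
    Finsupp.linearCombination _ fun s => simplex k (contraction X) s.1
  refine Module.Projective.of_split σ π (LinearMap.ext fun x => ?_)
  suffices h : (π.restrictScalars k).comp (σ.restrictScalars k) = LinearMap.id from
    LinearMap.congr_fun h x
  refine simplicialChains_ext fun s => ?_
  have hs := s.2.1.monotone
  have hfree (t : Fin (m + 1) → B) : π (freeSimplex k X t) = simplex k (contraction X) t := by
    rw [freeSimplex, map_extendChain, simplex]
    congr 1
    funext s
    rw [Finsupp.linearCombination_single, one_smul, simplex_coe]
  change π (σ₁ _) = _
  rw [hσ₁ _ hs s.2.2, LinearMap.id_apply]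
  have hterm (Z : SupportSemilattice B) : π ((single (s.1 (Fin.last m)) (1 : k) *
      primitiveElement k e Z) • freeSimplex k X fun i => e Z * s.1 i) =
      (single (s.1 (Fin.last m)) (1 : k) * primitiveElement k e Z) •
        simplex k (contraction X) s.1 := by
    rw [map_smul, hfree]
    by_cases hZ : X ≤ support (e Z)
    · rw [← single_smul_simplex_of_le hZ hs s.2.2, smul_smul, mul_assoc,
        primitiveElement_mul_single he Z _ (he Z).ge]
    · have h0 : simplex k (contraction X) (fun i => e Z * s.1 i) = 0 := by
        rw [simplex, extendChain_of_not]
        rintro ⟨-, h'⟩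
        have h2 : X ≤ support (e Z * s.1 (Fin.last m)) := h' (Fin.last m)
        exact hZ (le_support_mul.1 h2).1
      rw [h0, smul_zero, ← primitiveElement_mul_single he Z _ (he Z).ge, ← mul_assoc, mul_smul,
        single_smul_chain_of_not hZ, smul_zero]
  simp only [σ₀, map_sum, hterm]
  rw [← Finset.sum_smul, ← Finset.mul_sum, single_mul_sum_primitiveElement he,
    single_smul_simplex_of_le (s.2.2 _) hs s.2.2]
  congr 1
  funext i
  exact last_mul_eq hs i

end ChainModules

end LRB

/-! ### Computing `Ext` from the resolution by chains. -/

namespace LRB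

/-! ### Homology of cochain complexes of modules -/

section Homology

theorem nonempty_linearEquiv_shortComplex_homology {k : Type u} [CommRing k]
    (S : ShortComplex (ModuleCat.{u} k)) {E : Type*} [AddCommGroup E] [Module k E]
    (ψ : LinearMap.ker S.g.hom →ₗ[k] E) (hψ : Function.Surjective ψ)
    (hker : ∀ z : LinearMap.ker S.g.hom, ψ z = 0 ↔ ∃ y, S.f.hom y = z.1) :
    Nonempty (E ≃ₗ[k] S.homology) := by
  have h : LinearMap.ker ψ = LinearMap.range S.moduleCatToCycles := by
    ext z
    rw [LinearMap.mem_ker, hker, LinearMap.mem_range]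
    exact exists_congr fun y => (Subtype.ext_iff (a1 := S.moduleCatToCycles y) (a2 := z)).symm
  exact ⟨(ψ.quotKerEquivOfSurjective hψ).symm ≪≫ₗ Submodule.quotEquivOfEq _ _ h ≪≫ₗ
    S.moduleCatHomologyIso.symm.toLinearEquiv⟩

theorem nonempty_linearEquiv_homology {k : Type u} [CommRing k]
    (K : CochainComplex (ModuleCat.{u} k) ℕ) (n : ℕ) {E : Type*} [AddCommGroup E] [Module k E]
    (ψ : LinearMap.ker (K.d n (n + 1)).hom →ₗ[k] E) (hψ : Function.Surjective ψ)
    (hker : ∀ z : LinearMap.ker (K.d n (n + 1)).hom, ψ z = 0 ↔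
      ∃ y, (K.d ((ComplexShape.up ℕ).prev n) n).hom y = z.1) :
    Nonempty (E ≃ₗ[k] K.homology n) := by
  obtain ⟨φ⟩ := nonempty_linearEquiv_shortComplex_homology
    (K.sc' ((ComplexShape.up ℕ).prev n) n (n + 1)) ψ hψ hker
  exact ⟨φ ≪≫ₗ (K.homologyIsoSc' _ n (n + 1) rfl (by simp)).symm.toLinearEquiv⟩

/-- Isomorphic cochain complexes of modules have isomorphic homology. -/
theorem nonempty_homology_linearEquiv {k : Type u} [CommRing k]
    {K L : CochainComplex (ModuleCat.{u} k) ℕ} (φ : ∀ n, K.X n ≃ₗ[k] L.X n)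
    (hφ : ∀ n x, φ (n + 1) (K.d n (n + 1) x) = L.d n (n + 1) (φ n x)) (n : ℕ) :
    Nonempty (K.homology n ≃ₗ[k] L.homology n) := by
  refine ⟨((HomologicalComplex.homologyFunctor _ _ n).mapIso
    (HomologicalComplex.Hom.isoOfComponents (fun i => (φ i).toModuleIso) ?_)).toLinearEquiv⟩
  rintro i _ rfl
  ext x
  exact (hφ i x).symm

end Homology

/-! ### Extensions from projective resolutions -/

section Ext

open CategoryTheory.Abelian

variable {C : Type*} [Category* C] [Abelian C] [HasExt.{u} C] {X Y : C}
  (R : ProjectiveResolution X)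

theorem smul_extMk {k : Type*} [CommRing k] [Linear k C] {n : ℕ} (r : k) (f : R.complex.X n ⟶ Y)
    (m : ℕ) (hm : n + 1 = m) (hf : R.complex.d m n ≫ f = 0) :
    R.extMk (r • f) m hm (by simp [hf]) = r • R.extMk f m hm hf := by
  rw [Ext.smul_eq_comp_mk₀, ProjectiveResolution.extMk_comp_mk₀]
  congr 1
  simp

/-- In degree 0 there are no coboundaries: the resolution, regarded as a cochain complex, vanishes
in degree 1. -/
theorem extMk_zero_eq_zero_iff (f : R.complex.X 0 ⟶ Y) (hf : R.complex.d 1 0 ≫ f = 0) :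
    R.extMk f 1 rfl hf = 0 ↔ f = 0 := by
  constructor
  · intro h
    rw [← R.extEquivCohomologyClass.apply_eq_iff_eq, ProjectiveResolution.extEquivCohomologyClass_extMk,
      ProjectiveResolution.extEquivCohomologyClass_zero,
      CochainComplex.HomComplex.CohomologyClass.mk_eq_zero_iff,
      CochainComplex.HomComplex.Cocycle.toSingleMk_mem_coboundaries_iff _ _ _ _ _ 1 (by simp)] at h
    obtain ⟨g, hg⟩ := h
    have hz : Limits.IsZero (R.cochainComplex.X 1) :=
      CochainComplex.isZero_of_isStrictlyLE _ 0 _ (by simp)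
    rw [hz.eq_of_src g 0, Limits.comp_zero] at hg
    exact (Preadditive.IsIso.comp_left_eq_zero (R.cochainComplexXIso _ 0 rfl).hom f).1 hg.symm
  · rintro rfl
    simp

/-- The `Ext`-modules are the cohomology of any cochain complex isomorphic to the complex of
morphisms from a projective resolution. -/
theorem nonempty_ext_linearEquiv_homology {k : Type u} [CommRing k] [Linear k C]
    (K : CochainComplex (ModuleCat.{u} k) ℕ)
    (φ : ∀ n, (R.complex.X n ⟶ Y) ≃ₗ[k] K.X n)
    (hφ : ∀ n (f : R.complex.X n ⟶ Y),
      φ (n + 1) (R.complex.d (n + 1) n ≫ f) = (K.d n (n + 1)).hom (φ n f)) (n : ℕ) :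
    Nonempty (Ext X Y n ≃ₗ[k] K.homology n) := by
  have hcocycle (z : LinearMap.ker (K.d n (n + 1)).hom) :
      R.complex.d (n + 1) n ≫ (φ n).symm z = 0 := by
    apply (φ (n + 1)).injective
    rw [hφ, map_zero, LinearEquiv.apply_symm_apply]
    exact z.2
  let ψ : LinearMap.ker (K.d n (n + 1)).hom →ₗ[k] Ext X Y n :=
    { toFun z := R.extMk ((φ n).symm z) (n + 1) rfl (hcocycle z)
      map_add' z w := by
        rw [ProjectiveResolution.add_extMk]
        congr 1
        simp
      map_smul' r z := by
        rw [RingHom.id_apply, ← smul_extMk]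
        congr 1
        simp }
  refine nonempty_linearEquiv_homology K n ψ (fun α => ?_) fun z => ?_
  · obtain ⟨f, hf, rfl⟩ := R.extMk_surjective α (n + 1) rfl
    refine ⟨⟨φ n f, ?_⟩, ?_⟩
    · rw [LinearMap.mem_ker, ← hφ, hf, map_zero]
    · change R.extMk ((φ n).symm (φ n f)) (n + 1) rfl (by simpa using hf) = _
      simp only [LinearEquiv.symm_apply_apply]
  · change R.extMk ((φ n).symm z.1) (n + 1) rfl (hcocycle z) = 0 ↔ _
    -- Degree 0 has no true predecessor and the differential into it is zero; in degree `n + 1` the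
    -- predecessor is `n`.
    obtain ⟨p, hp⟩ : ∃ p, p = (ComplexShape.up ℕ).prev n := ⟨_, rfl⟩
    rw [← hp]
    cases n with
    | zero =>
      rw [extMk_zero_eq_zero_iff, K.shape p 0 (by simp)]
      simp only [ModuleCat.hom_zero, LinearMap.zero_apply, exists_const]
      rw [eq_comm (a := (0 : K.X 0))]
      simp
    | succ n =>
      obtain rfl : p = n := by simp [hp]
      rw [R.extMk_eq_zero_iff _ _ _ _ p rfl]
      constructor
      · rintro ⟨g, hg⟩
        refine ⟨φ p g, ?_⟩
        rw [← hφ, hg, LinearEquiv.apply_symm_apply]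
      · rintro ⟨y, hy⟩
        refine ⟨(φ p).symm y, (φ (p + 1)).injective ?_⟩
        rw [hφ, LinearEquiv.apply_symm_apply, LinearEquiv.apply_symm_apply, hy]

theorem subsingleton_ext_of_projectiveResolution {n : ℕ}
    (h : ∀ f : R.complex.X n ⟶ Y, f = 0) : Subsingleton (Ext X Y n) := by
  refine subsingleton_of_forall_eq 0 fun α => ?_
  obtain ⟨f, hf, rfl⟩ := R.extMk_surjective α (n + 1) rfl
  obtain rfl := h f
  simp

theorem subsingleton_ext_succ_of_projectiveResolution {n : ℕ}
    (h : ∀ f : R.complex.X (n + 1) ⟶ Y, R.complex.d (n + 2) (n + 1) ≫ f = 0 →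
      ∃ g, R.complex.d (n + 1) n ≫ g = f) : Subsingleton (Ext X Y (n + 1)) := by
  refine subsingleton_of_forall_eq 0 fun α => ?_
  obtain ⟨f, hf, rfl⟩ := R.extMk_surjective α (n + 2) rfl
  rw [R.extMk_eq_zero_iff _ _ _ _ n rfl]
  exact h f hf

end Ext

/-! ### The projective resolution -/

/-- A projective resolution given by an exact augmented complex of projective objects. -/
noncomputable def projectiveResolutionOfExact {C : Type*} [Category* C] [Abelian C]
    (K : ChainComplex C ℕ) (hK : ∀ n, Projective (K.X n)) {Z : C} (ε : K.X 0 ⟶ Z)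
    (w : K.d 1 0 ≫ ε = 0) (hε : Epi ε) (h₀ : (ShortComplex.mk _ _ w).Exact)
    (h : ∀ n, K.ExactAt (n + 1)) : ProjectiveResolution Z where
  complex := K
  projective := hK
  π := (ChainComplex.toSingle₀Equiv _ _).symm ⟨ε, w⟩
  quasiIso := ⟨fun n => by
    cases n with
    | zero =>
      rw [ChainComplex.quasiIsoAt₀_iff, ShortComplex.quasiIso_iff_of_zeros']
      · refine (ShortComplex.exact_and_epi_g_iff_of_iso ?_).2 ⟨h₀, hε⟩
        exact ShortComplex.isoMk (Iso.refl _) (Iso.refl _) (Iso.refl _)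
          ((Category.id_comp _).trans (Category.comp_id _).symm)
          (by
            simp only [Iso.refl_hom, HomologicalComplex.shortComplexFunctor'_map_τ₂,
              ChainComplex.toSingle₀Equiv_symm_apply_f_zero]
            exact (Category.id_comp _).trans (Category.comp_id _).symm)
      · exact K.shape _ _ (by simp)
      · rfl
      · rfl
    | succ n =>
      rw [quasiIsoAt_iff_exactAt']
      · exact h n
      · apply ChainComplex.exactAt_succ_single_obj⟩

section Resolution

open MonoidAlgebra

variable {k B : Type u} [CommRing k] [LeftRegularBand B] [IsUnital k B]

instance uniqueChainZero {P : Type u} [PartialOrder P] (S : Set P) : Unique (Chain S 0) where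
  default := ⟨Fin.elim0, fun i => i.elim0, fun i => i.elim0⟩
  uniq _ := Subtype.ext (funext fun i => i.elim0)

/-- The coefficient of the empty chain, as a map of modules over the semigroup algebra. -/
noncomputable def emptyChainCoeff (X : SupportSemilattice B) :
    SimplicialChains k (contraction X) 0 →ₗ[MonoidAlgebra k B] Isotypic X k :=
  linearMapOfEquivariant (Finsupp.linearCombination k fun _ => ((1 : k) : Isotypic X k))
    fun b x => by
      by_cases h : X ≤ support b
      · rw [single_smul_isotypic_of_le h, single_smul_chain]
        suffices h' : (Finsupp.linearCombination k fun _ => ((1 : k) : Isotypic X k)).comp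
            (chainAction k X 0 b) = Finsupp.linearCombination k fun _ => ((1 : k) : Isotypic X k) from
          LinearMap.congr_fun h' x
        refine simplicialChains_ext fun s => ?_
        rw [LinearMap.comp_apply, chainAction_of_mem h s.2.1.monotone s.2.2]
        congr 2
        funext i
        exact i.elim0
      · rw [single_smul_isotypic_of_not h, single_smul_chain_of_not h, map_zero]

/-- Identifies `k_X` with the span of the empty chain, so that exactness at the augmentation is the
case of lowest degree of the exactness of augmented chains. -/
theorem emptyChainCoeff_bijective (X : SupportSemilattice B) :
    Function.Bijective (emptyChainCoeff (k := k) X) := by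
  have h (x : SimplicialChains k (contraction X) 0) : emptyChainCoeff X x = x default := by
    refine (Finsupp.linearCombination_unique k _ _).trans ?_
    exact mul_one (x default)
  constructor
  · intro x y hxy
    rw [h, h] at hxy
    exact Finsupp.ext fun s => by rwa [Unique.eq_default s]
  · intro r
    exact ⟨Finsupp.single default r, (h _).trans (Finsupp.single_eq_same)⟩

variable (k) in
/-- The complex of simplicial chains of a contraction. -/
noncomputable def chainComplex (X : SupportSemilattice B) :
    ChainComplex (ModuleCat.{u} (MonoidAlgebra k B)) ℕ :=
  ChainComplex.of (fun m => ModuleCat.of _ (SimplicialChains k (contraction X) (m + 1)))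
    (fun m => ModuleCat.ofHom (boundaryHom X (m + 1)))
    (fun m => by
      refine ModuleCat.hom_ext (LinearMap.ext fun x => ?_)
      exact boundary_boundary (m + 1) x)

theorem chainComplex_d (X : SupportSemilattice B) (m : ℕ) :
    (chainComplex k X).d (m + 1) m = ModuleCat.ofHom (boundaryHom X (m + 1)) :=
  ChainComplex.of_d (fun m => ModuleCat.of _ (SimplicialChains k (contraction X) (m + 1)))
    (fun m => ModuleCat.ofHom (boundaryHom X (m + 1))) m

theorem chainComplex_d_apply (X : SupportSemilattice B) (m : ℕ)
    (x : SimplicialChains k (contraction X) (m + 2)) :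
    ((chainComplex k X).d (m + 1) m).hom x = boundary k (contraction X) (m + 1) x := by
  rw [chainComplex_d]
  rfl

variable (k) in
/-- The augmentation of the complex of simplicial chains of a contraction. -/
noncomputable def augmentation (X : SupportSemilattice B) :
    (chainComplex k X).X 0 ⟶ supportModule k X :=
  show ModuleCat.of _ (SimplicialChains k (contraction X) 1) ⟶ ModuleCat.of _ (Isotypic X k) from
    ModuleCat.ofHom ((emptyChainCoeff X).comp (boundaryHom X 0))

theorem chainComplex_d_comp_augmentation (X : SupportSemilattice B) :
    (chainComplex k X).d 1 0 ≫ augmentation k X = 0 := by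
  rw [chainComplex_d]
  refine ModuleCat.hom_ext (LinearMap.ext fun x => ?_)
  exact (congrArg (emptyChainCoeff X)
    (boundary_boundary 0 (x : SimplicialChains k (contraction X) 2))).trans (map_zero _)

variable [Finite B]

theorem augmentation_surjective (X : SupportSemilattice B) :
    Function.Surjective (augmentation k X) :=
  (emptyChainCoeff_bijective X).2.comp (boundary_zero_surjective X)

variable (k) in
/-- The simplicial chains of a contraction form a projective resolution. -/
noncomputable def chainResolution (X : SupportSemilattice B) :
    ProjectiveResolution (supportModule k X) :=
  projectiveResolutionOfExact (chainComplex k X)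
    (fun n => have := projective_chains (k := k) X n
      (IsProjective.iff_projective _).1 this)
    (augmentation k X) (chainComplex_d_comp_augmentation X)
    ((ModuleCat.epi_iff_surjective _).2 (augmentation_surjective X))
    (by
      rw [ShortComplex.moduleCat_exact_iff]
      intro x hx
      have h1 : boundary k (contraction X) 0 x = 0 := by
        apply (emptyChainCoeff_bijective X).1
        rw [map_zero]
        exact hx
      obtain ⟨y, hy⟩ := exists_boundary_eq _ h1
      refine ⟨y, ?_⟩
      exact (chainComplex_d_apply X 0 y).trans hy)
    (fun n => by
      rw [HomologicalComplex.exactAt_iff' _ (n + 2) (n + 1) n (by simp) (by simp),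
        ShortComplex.moduleCat_exact_iff]
      intro x hx
      obtain ⟨y, hy⟩ := exists_boundary_eq _ ((chainComplex_d_apply X n x).symm.trans hx)
      exact ⟨y, (chainComplex_d_apply X (n + 1) y).trans hy⟩)

end Resolution

end LRB

/-! ### Morphisms from chains to `k_Y` as cochains of the boundary of a cell. -/

namespace LRB

open MonoidAlgebra

/-! ### Morphisms from the modules of chains -/

section Cells

variable {B : Type u} [LeftRegularBand B] {X : SupportSemilattice B} {e : B}

theorem mem_cell (hX : X ≤ support e) {x : B} : x ∈ cell e X ↔ x ≤ e ∧ X ≤ support x := by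
  constructor
  · rintro ⟨a, ha, rfl⟩
    exact ⟨mul_le_left e a, le_support_mul.2 ⟨hX, ha⟩⟩
  · rintro ⟨h, hx⟩
    exact ⟨x, hx, h.symm⟩

theorem mem_cellBoundary (hX : X ≤ support e) {x : B} :
    x ∈ cellBoundary e X ↔ x < e ∧ X ≤ support x := by
  rw [cellBoundary, Set.mem_sdiff, mem_cell hX, Set.mem_singleton_iff, lt_iff_le_and_ne]
  tauto

/-- Below a given element, passing to a strictly smaller element strictly lowers the support. Hence
the elements of the boundary of a cell annihilate the simple module attached to the cell. -/
theorem not_support_le_of_lt {x : B} (h : x < e) : ¬ support e ≤ support x := by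
  intro h'
  have h1 : e * x = x := h.le
  exact h.ne (h1.symm.trans (support_le.1 h'))

theorem appendLast_mem_contraction (hX : X ≤ support e) {m : ℕ} (s : Chain (cellBoundary e X) m)
    (i : Fin (m + 1)) : X ≤ support (appendLast s.1 e i) :=
  appendLast_mem (S := contraction X) (fun i => ((mem_cellBoundary hX).1 (s.2.2 i)).2) hX i

theorem appendLast_strictMono_of_cellBoundary (hX : X ≤ support e) {m : ℕ}
    (s : Chain (cellBoundary e X) m) : StrictMono (appendLast s.1 e) :=
  appendLast_strictMono s.2.1 fun i => ((mem_cellBoundary hX).1 (s.2.2 i)).1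

theorem appendLast_mem_cell (hX : X ≤ support e) {m : ℕ} (s : Chain (cellBoundary e X) m)
    (i : Fin (m + 1)) : appendLast s.1 e i ∈ cell e X :=
  appendLast_mem (S := cell e X) (fun i => (s.2.2 i).1) ((mem_cell hX).2 ⟨le_rfl, hX⟩) i

/-- The chain in a cell obtained from a chain in its boundary by adding the top element. -/
def topChain (hX : X ≤ support e) {m : ℕ} (s : Chain (cellBoundary e X) m) :
    Chain (cell e X) (m + 1) :=
  ⟨appendLast s.1 e, appendLast_strictMono_of_cellBoundary hX s, appendLast_mem_cell hX s⟩

variable {k : Type u} [CommRing k]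

open Classical in
/-- The extension of a cochain of the boundary of a cell to the tuples in a contraction. -/
noncomputable def extendCochain (e : B) (X : SupportSemilattice B) {m : ℕ}
    (g : Chain (cellBoundary e X) m → k) (t : Fin (m + 1) → B) : k :=
  -- Multiplication by `e` moves `t` into the cell; only chains that then have top `e` count, and
  -- removing the top gives a chain of the boundary.
  if e * t (Fin.last m) = e then extendChain (cellBoundary e X) g fun i => e * t i.castSucc else 0

theorem monotone_mul (b : B) {m : ℕ} {t : Fin m → B} (ht : Monotone t) :
    Monotone fun i => b * t i :=
  (mul_monotone b).comp ht

theorem strictMono_of_mul_strictMono {m : ℕ} {t : Fin m → B} (ht : Monotone t)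
    (h : StrictMono fun i => e * t i) : StrictMono t :=
  ht.strictMono_of_injective (Function.Injective.of_comp (f := fun x => e * x) h.injective)

theorem eq_appendLast {P : Type*} {m : ℕ} {t : Fin (m + 1) → P} {b : P} (h : t (Fin.last m) = b) :
    t = appendLast (fun i => t i.castSucc) b := by
  subst h
  exact (Fin.snoc_init_self t).symm

theorem extendCochain_congr {m : ℕ} (g : Chain (cellBoundary e X) m → k)
    {t t' : Fin (m + 1) → B} (h : ∀ i, e * t i = e * t' i) :
    extendCochain e X g t = extendCochain e X g t' := by
  have h' : (fun i : Fin m => e * t i.castSucc) = fun i => e * t' i.castSucc :=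
    funext fun i => h _
  rw [extendCochain, extendCochain, h', h]

theorem extendCochain_of_not (hX : X ≤ support e) {m : ℕ} (g : Chain (cellBoundary e X) m → k)
    {t : Fin (m + 1) → B} (h : ¬ StrictMono fun i => e * t i) : extendCochain e X g t = 0 := by
  rw [extendCochain]
  split_ifs with he
  · refine extendChain_of_not _ fun h' => h ?_
    rw [eq_appendLast (t := fun i => e * t i) he]
    exact appendLast_strictMono_of_cellBoundary hX ⟨_, h'⟩
  · rfl

theorem extendCochain_appendLast (hX : X ≤ support e) {m : ℕ} (g : Chain (cellBoundary e X) m → k)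
    (s : Chain (cellBoundary e X) m) : extendCochain e X g (appendLast s.1 e) = g s := by
  rw [extendCochain, if_pos (by simp [appendLast, LeftRegularBand.mul_self])]
  rw [← extendChain_coe g s]
  congr 1
  funext i
  have h : e * s.1 i = s.1 i := ((mem_cellBoundary hX).1 (s.2.2 i)).1.le
  simp [appendLast, h]

variable (k) in
/-- An element of `k`, as an element of the simple module. -/
def isotypicMk (X : SupportSemilattice B) (r : k) : Isotypic X k := r

/-- An element of the simple module, as an element of `k`. -/
def isotypicVal {X : SupportSemilattice B} (r : Isotypic X k) : k := r

/-- The linear map underlying `homOfCochain`. -/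
noncomputable def linearMapOfCochain (e : B) (X : SupportSemilattice B) {m : ℕ}
    (g : Chain (cellBoundary e X) m → k) :
    SimplicialChains k (contraction X) (m + 1) →ₗ[k] Isotypic (support e) k :=
  Finsupp.linearCombination k fun s => isotypicMk k (support e) (extendCochain e X g s.1)

theorem linearMapOfCochain_simplex (hX : X ≤ support e) {m : ℕ}
    (g : Chain (cellBoundary e X) m → k) {t : Fin (m + 1) → B} (ht : Monotone t)
    (htX : ∀ i, X ≤ support (t i)) :
    linearMapOfCochain e X g (simplex k (contraction X) t) =
      isotypicMk k (support e) (extendCochain e X g t) := by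
  rw [linearMapOfCochain, linearCombination_simplex]
  by_cases h : StrictMono t
  · rw [extendChain_of_mem _ ⟨h, htX⟩]
  · rw [extendChain_of_not _ fun h' => h h'.1,
      extendCochain_of_not hX _ fun h' => h (strictMono_of_mul_strictMono ht h')]
    rfl

variable [IsUnital k B]

/-- A morphism from the module of chains to a simple module vanishes on the chains in the
boundary of a cell. -/
theorem hom_simplex_eq_zero {V : Type*} [AddCommGroup V] [Module k V] {m : ℕ}
    (f : SimplicialChains k (contraction X) (m + 1) →ₗ[MonoidAlgebra k B] Isotypic (support e) V)
    {t : Fin (m + 1) → B} (ht : Monotone t) (htX : ∀ i, X ≤ support (t i))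
    (hlt : t (Fin.last m) < e) : f (simplex k _ t) = 0 := by
  have h1 : single (t (Fin.last m)) (1 : k) • simplex k (contraction X) t = simplex k _ t := by
    rw [single_smul_simplex_of_le (htX _) ht htX]
    congr 1
    funext i
    exact last_mul_eq ht i
  rw [← h1, map_smul, single_smul_isotypic_of_not (not_support_le_of_lt hlt)]

theorem hom_simplex_mul {V : Type*} [AddCommGroup V] [Module k V] (hX : X ≤ support e) {m : ℕ}
    (f : SimplicialChains k (contraction X) m →ₗ[MonoidAlgebra k B] Isotypic (support e) V)
    {t : Fin m → B} (ht : Monotone t) (htX : ∀ i, X ≤ support (t i)) :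
    f (simplex k _ t) = f (simplex k _ fun i => e * t i) := by
  rw [← single_smul_simplex_of_le hX ht htX, map_smul, single_smul_isotypic_of_le le_rfl]

/-- The element `e` kills the chains of `B_{≥X}` but acts as the identity on the target. -/
theorem hom_eq_zero {V : Type*} [AddCommGroup V] [Module k V] (hX : ¬ X ≤ support e) {m : ℕ}
    (f : SimplicialChains k (contraction X) m →ₗ[MonoidAlgebra k B] Isotypic (support e) V) :
    f = 0 := by
  refine LinearMap.ext fun x => ?_
  rw [LinearMap.zero_apply, ← single_smul_isotypic_of_le (k := k) (le_refl (support e)) (f x),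
    ← map_smul, single_smul_chain_of_not hX, map_zero]

theorem linearMapOfCochain_smul (hX : X ≤ support e) {m : ℕ}
    (g : Chain (cellBoundary e X) m → k) (b : B)
    (x : SimplicialChains k (contraction X) (m + 1)) :
    linearMapOfCochain e X g (single b (1 : k) • x) =
      single b (1 : k) • linearMapOfCochain e X g x := by
  rw [single_smul_chain]
  suffices h : (linearMapOfCochain e X g).comp (chainAction k X (m + 1) b) =
      (DistribSMul.toLinearMap k (Isotypic (support e) k) (single b (1 : k))).comp
        (linearMapOfCochain e X g) from LinearMap.congr_fun h x
  refine simplicialChains_ext fun s => ?_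
  have hs := s.2.1.monotone
  rw [LinearMap.comp_apply, LinearMap.comp_apply, linearMapOfCochain_simplex hX g hs s.2.2,
    DistribSMul.toLinearMap_apply]
  by_cases hb : support e ≤ support b
  · rw [single_smul_isotypic_of_le hb, chainAction_of_mem (hX.trans hb) hs s.2.2,
      linearMapOfCochain_simplex hX g (monotone_mul b hs)
        fun i => le_support_mul.2 ⟨hX.trans hb, s.2.2 i⟩]
    refine congrArg _ (extendCochain_congr g fun i => ?_)
    rw [← mul_assoc, support_le.1 hb]
  · rw [single_smul_isotypic_of_not hb]
    by_cases hb' : X ≤ support b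
    · rw [chainAction_of_mem hb' hs s.2.2,
        linearMapOfCochain_simplex hX g (monotone_mul b hs)
          -- If `e b t_m = e`, where `t_m` is the top of the chain, then the support of `e` lies
          -- below that of `b`, contrary to assumption.
          fun i => le_support_mul.2 ⟨hb', s.2.2 i⟩, extendCochain, if_neg]
      · rfl
      · intro h
        refine hb ?_
        rw [← h]
        exact (support_mul_le_right _ _).trans (support_mul_le_left _ _)
    · rw [chainAction_of_not hb', LinearMap.zero_apply, map_zero]

/-- The morphism from the module of chains given by a cochain of the boundary of a cell. -/
noncomputable def homOfCochain (hX : X ≤ support e) {m : ℕ} (g : Chain (cellBoundary e X) m → k) :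
    SimplicialChains k (contraction X) (m + 1) →ₗ[MonoidAlgebra k B] Isotypic (support e) k :=
  linearMapOfEquivariant (linearMapOfCochain e X g) (linearMapOfCochain_smul hX g)

theorem homOfCochain_simplex (hX : X ≤ support e) {m : ℕ} (g : Chain (cellBoundary e X) m → k)
    {t : Fin (m + 1) → B} (ht : StrictMono t) (htX : ∀ i, X ≤ support (t i)) :
    homOfCochain hX g (simplex k (contraction X) t) =
      isotypicMk k (support e) (extendCochain e X g t) :=
  linearMapOfCochain_simplex hX g ht.monotone htX

/-- The morphisms from the module of chains to a simple module are the cochains of the boundary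
of a cell. -/
noncomputable def homEquivCochain (hX : X ≤ support e) (m : ℕ) :
    (SimplicialChains k (contraction X) (m + 1) →ₗ[MonoidAlgebra k B] Isotypic (support e) k) ≃+
      (Chain (cellBoundary e X) m → k) where
  toFun f s := isotypicVal (f (simplex k (contraction X) (appendLast s.1 e)))
  invFun g := homOfCochain hX g
  map_add' f g := rfl
  left_inv f := by
    suffices h : (homOfCochain hX fun s =>
        isotypicVal (f (simplex k (contraction X) (appendLast s.1 e)))).restrictScalars k =
        f.restrictScalars k from
      LinearMap.ext fun x => LinearMap.congr_fun h x
    refine simplicialChains_ext fun s => ?_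
    have hs := s.2.1.monotone
    rw [LinearMap.restrictScalars_apply, LinearMap.restrictScalars_apply,
      homOfCochain_simplex hX _ s.2.1 s.2.2, hom_simplex_mul hX f hs s.2.2]
    have hes := monotone_mul e hs
    have hesX (i : Fin (m + 1)) : X ≤ support (e * s.1 i) := le_support_mul.2 ⟨hX, s.2.2 i⟩
    by_cases h : StrictMono fun i => e * s.1 i
    -- After multiplication by `e` the chain either has top `e`, and is recovered from its lower
    -- part, or has a smaller top, and then `f` kills it.
    · rw [extendCochain]
      split_ifs with he
      · rw [extendChain_of_mem]
        · refine congrArg (fun t => f (simplex k (contraction X) t)) ?_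
          exact (eq_appendLast (t := fun i => e * s.1 i) he).symm
        · refine ⟨h.comp Fin.strictMono_castSucc, fun i => (mem_cellBoundary hX).2 ⟨?_, hesX _⟩⟩
          have h1 := h (Fin.castSucc_lt_last i)
          exact h1.trans_eq he
      · exact (hom_simplex_eq_zero f hes hesX (lt_of_le_of_ne (mul_le_left _ _) he)).symm
    · rw [extendCochain_of_not hX _ h, simplex, extendChain_of_not _ fun h' => h h'.1, map_zero]
      rfl
  right_inv g := by
    funext s
    refine (homOfCochain_simplex hX g (appendLast_strictMono_of_cellBoundary hX s)
      (appendLast_mem_contraction hX s)).trans ?_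
    rw [extendCochain_appendLast hX]
    rfl

/-- The last face omits the top `e` and lies in the boundary of the cell, where `f` vanishes. The
remaining faces are those of the chain below `e`, with the same signs. -/
theorem homEquivCochain_comp_boundary (hX : X ≤ support e) (m : ℕ)
    (f : SimplicialChains k (contraction X) (m + 1) →ₗ[MonoidAlgebra k B]
      Isotypic (support e) k) :
    homEquivCochain hX (m + 1) (f.comp (boundaryHom X (m + 1))) =
      coboundary k (cellBoundary e X) m (homEquivCochain hX m f) := by
  funext s
  change f (boundary k _ _ (simplex k _ (appendLast s.1 e))) =
    ∑ i : Fin (m + 1), (-1 : k) ^ (i : ℕ) • f (simplex k _ (appendLast (s.face i).1 e))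
  rw [boundary_simplex (appendLast_strictMono_of_cellBoundary hX s).monotone
    (appendLast_mem_contraction hX s), map_sum, Fin.sum_univ_castSucc, appendLast_last_succAbove,
    map_zsmul f, hom_simplex_eq_zero f s.2.1.monotone
      (fun i => ((mem_cellBoundary hX).1 (s.2.2 i)).2) ((mem_cellBoundary hX).1 (s.2.2 _)).1,
    smul_zero, add_zero]
  refine Finset.sum_congr rfl fun i _ => ?_
  have h (n : ℕ) (x : k) : (-1 : ℤ) ^ n • x = (-1 : k) ^ n * x := by simp
  rw [appendLast_castSucc_succAbove, map_zsmul f]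
  exact h _ _

end Cells

end LRB

/-! ### Relative and reduced cohomology of cells, and the `Ext` modules. -/

namespace LRB

open MonoidAlgebra CategoryTheory.Abelian

/-! ### The cochain complexes of cells and their boundaries -/

section Cohomology

variable {P : Type u} [PartialOrder P] {k : Type u} [CommRing k]

theorem augmentedCochainComplex_d_apply (S : Set P) (m : ℕ) (f : Chain S m → k) :
    ((augmentedCochainComplex k S).d m (m + 1)).hom f = coboundary k S m f :=
  congrArg (fun φ => φ.hom f) (CochainComplex.of_d (fun m => ModuleCat.of k (Chain S m → k))
    (fun m => ModuleCat.ofHom (coboundary k S m)) m)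

theorem relCochainComplex_d_apply (S T : Set P) (m : ℕ) (f : relCochains k S T (m + 1)) :
    ((relCochainComplex k S T).d m (m + 1)).hom f =
      (coboundary k S (m + 1)).restrict (coboundary_mem_relCochains k S T (m + 1)) f :=
  congrArg (fun φ => φ.hom f)
    (CochainComplex.of_d (fun q => ModuleCat.of k (relCochains k S T (q + 1)))
    (fun q => ModuleCat.ofHom
      ((coboundary k S (q + 1)).restrict (coboundary_mem_relCochains k S T (q + 1)))) m)

theorem subsingleton_homology_of_subsingleton (K : CochainComplex (ModuleCat.{u} k) ℕ) (n : ℕ)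
    (h : Subsingleton (K.X n)) : Subsingleton (K.homology n) := by
  rw [← ModuleCat.isZero_iff_subsingleton]
  have hK : Limits.IsZero (K.X n) := ModuleCat.isZero_iff_subsingleton.2 h
  exact ShortComplex.isZero_homology_of_isZero_X₂ (K.sc n) hK

/-- The reduced cohomology of the empty complex in degree `-1`. -/
theorem nonempty_shiftedReducedCohomology_empty {S : Set P} (hS : S = ∅) :
    Nonempty (k ≃ₗ[k] shiftedReducedCohomology k S 0) := by
  have hempty : IsEmpty (Chain S 1) := ⟨fun s => by
    exact hS.subset (s.2.2 0)⟩
  have hzero (f : Chain S 0 → k) : ((augmentedCochainComplex k S).d 0 1).hom f = 0 := by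
    rw [augmentedCochainComplex_d_apply]
    exact funext fun s => hempty.elim s
  refine nonempty_linearEquiv_homology (augmentedCochainComplex k S) 0
    ((LinearMap.proj (R := k) (φ := fun _ : Chain S 0 => k) default).comp (Submodule.subtype _))
    (fun r => ⟨⟨fun _ => r, hzero _⟩, rfl⟩) fun z => ?_
  have hd (y) : ((augmentedCochainComplex k S).d ((ComplexShape.up ℕ).prev 0) 0).hom y = 0 := by
    rw [HomologicalComplex.shape _ _ _ (by simp)]
    rfl
  simp only [hd, exists_const]
  constructor
  · intro h
    funext s
    rw [Unique.eq_default s]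
    exact h.symm
  · intro h
    exact (congrFun h default).symm

/-- A cochain in the lowest degree is one scalar, and the coboundary copies it to every vertex; one
vertex suffices for injectivity. -/
theorem subsingleton_shiftedReducedCohomology_zero {S : Set P} (hS : S.Nonempty) :
    Subsingleton (shiftedReducedCohomology k S 0) := by
  obtain ⟨x, hx⟩ := hS
  have hinj (z : Chain S 0 → k) (hz : ((augmentedCochainComplex k S).d 0 1).hom z = 0) :
      z = 0 := by
    rw [augmentedCochainComplex_d_apply] at hz
    funext s
    let t : Chain S 1 := ⟨fun _ => x, Subsingleton.strictMono (α := Fin 1) _, fun _ => hx⟩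
    have h : ∑ i : Fin 1, (-1 : k) ^ (i : ℕ) * z (t.face i) = 0 := congrFun hz t
    rw [Fin.sum_univ_one, Fin.val_zero, pow_zero, one_mul] at h
    exact (congrArg z (Subsingleton.elim _ _)).trans h
  obtain ⟨φ⟩ := nonempty_linearEquiv_homology (E := PUnit) (augmentedCochainComplex k S) 0 0
    (fun _ => ⟨0, rfl⟩) fun z => by
      refine ⟨fun _ => ⟨0, ?_⟩, fun _ => rfl⟩
      rw [map_zero]
      exact (hinj z.1 z.2).symm
  exact φ.symm.injective.subsingleton

theorem subsingleton_shiftedReducedCohomology_of_isEmpty {S : Set P} {n : ℕ}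
    (h : IsEmpty (Chain S n)) : Subsingleton (shiftedReducedCohomology k S n) :=
  subsingleton_homology_of_subsingleton _ _
    (inferInstanceAs (Subsingleton (Chain S n → k)))

end Cohomology

section RelativeCohomology

variable {k B : Type u} [CommRing k] [LeftRegularBand B] {X : SupportSemilattice B} {e : B}

theorem chain_cell_last (hX : X ≤ support e) {m : ℕ} (s : Chain (cell e X) (m + 1)) :
    (∀ i, s.1 i ∈ cellBoundary e X) ∨ ∃ t : Chain (cellBoundary e X) m, topChain hX t = s := by
  by_cases h : s.1 (Fin.last m) = e
  · refine .inr ⟨⟨fun i => s.1 i.castSucc, s.2.1.comp Fin.strictMono_castSucc, fun i => ?_⟩, ?_⟩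
    · exact (mem_cellBoundary hX).2 ⟨(s.2.1 (Fin.castSucc_lt_last i)).trans_eq h,
        ((mem_cell hX).1 (s.2.2 _)).2⟩
    · exact Subtype.ext (eq_appendLast h).symm
  · refine .inl fun i => (mem_cellBoundary hX).2 ⟨?_, ((mem_cell hX).1 (s.2.2 _)).2⟩
    exact (s.2.1.monotone (Fin.le_last i)).trans_lt
      (lt_of_le_of_ne ((mem_cell hX).1 (s.2.2 _)).1 h)

theorem topChain_injective (hX : X ≤ support e) {m : ℕ} :
    Function.Injective (topChain hX (m := m)) := by
  intro s t h
  refine Subtype.ext (funext fun i => ?_)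
  have h' := congrFun (congrArg Subtype.val h) i.castSucc
  simpa [topChain, appendLast] using h'

theorem topChain_not_mem (hX : X ≤ support e) {m : ℕ} (s : Chain (cellBoundary e X) m) :
    ¬ ∀ i, (topChain hX s).1 i ∈ cellBoundary e X := by
  intro h
  have h' := ((mem_cellBoundary hX).1 (h (Fin.last m))).1
  simp [topChain, appendLast] at h'

theorem cellBoundary_eq_empty : cellBoundary e (support e) = ∅ := by
  refine Set.eq_empty_of_forall_notMem fun x hx => ?_
  obtain ⟨h1, h2⟩ := (mem_cellBoundary le_rfl).1 hx
  exact not_support_le_of_lt h1 h2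

/-- For `b` of support `X`, the product `eb` lies in the cell and has support `X`, hence differs
from `e`. -/
theorem cellBoundary_nonempty (hX : X < support e) : (cellBoundary e X).Nonempty := by
  obtain ⟨b, rfl⟩ := exists_support_eq X
  refine ⟨e * b, (mem_cellBoundary hX.le).2 ⟨lt_of_le_of_ne (mul_le_left e b) fun h => ?_, ?_⟩⟩
  · exact hX.not_ge (h ▸ support_mul_le_right e b)
  · exact le_support_mul.2 ⟨hX.le, le_rfl⟩

open Classical in
/-- Restricting a relative cochain of a cell to the chains containing the top element. -/
noncomputable def relCochainsEquiv (hX : X ≤ support e) (m : ℕ) :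
    relCochains k (cell e X) (cellBoundary e X) (m + 1) ≃ₗ[k] (Chain (cellBoundary e X) m → k) where
  toFun f s := f.1 (topChain hX s)
  map_add' _ _ := rfl
  map_smul' _ _ := rfl
  invFun g := ⟨fun s => if h : ∃ t, topChain hX t = s then g h.choose else 0, fun s hs =>
    dif_neg fun ⟨t, ht⟩ => topChain_not_mem hX t (ht ▸ hs)⟩
  left_inv f := by
    refine Subtype.ext (funext fun s => ?_)
    dsimp only
    split_ifs with h
    · rw [h.choose_spec]
    · exact (f.2 s ((chain_cell_last hX s).resolve_right h)).symm
  right_inv g := by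
    funext s
    have h : ∃ t, topChain hX t = topChain hX s := ⟨s, rfl⟩
    change (if h : ∃ t, topChain hX t = topChain hX s then g h.choose else 0) = g s
    rw [dif_pos h, topChain_injective hX h.choose_spec]

/-- As for morphisms, the face omitting the top lies in the boundary of the cell, where a relative
cochain vanishes. -/
theorem relCochainsEquiv_coboundary (hX : X ≤ support e) (m : ℕ)
    (f : relCochains k (cell e X) (cellBoundary e X) (m + 1)) :
    relCochainsEquiv hX (m + 1) ((coboundary k (cell e X) (m + 1)).restrict
      (coboundary_mem_relCochains k _ _ (m + 1)) f) =
      coboundary k (cellBoundary e X) m (relCochainsEquiv hX m f) := by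
  funext s
  change ∑ i : Fin (m + 2), (-1 : k) ^ (i : ℕ) * f.1 ((topChain hX s).face i) =
    ∑ i : Fin (m + 1), (-1 : k) ^ (i : ℕ) * f.1 (topChain hX (s.face i))
  rw [Fin.sum_univ_castSucc]
  have h1 : f.1 ((topChain hX s).face (Fin.last (m + 1))) = 0 := by
    refine f.2 _ fun i => ?_
    have h := congrFun (appendLast_last_succAbove s.1 e) i
    change appendLast s.1 e _ ∈ _
    rw [h]
    exact s.2.2 i
  rw [h1, mul_zero, add_zero]
  refine Finset.sum_congr rfl fun i _ => ?_
  have h2 : (topChain hX s).face i.castSucc = topChain hX (s.face i) :=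
    Subtype.ext (appendLast_castSucc_succAbove s.1 e i)
  rw [h2, Fin.val_castSucc]

variable (k) in
-- A `q`-simplex containing the top element `e` corresponds to a chain of `q` elements in the
-- boundary, so the index shift in `shiftedReducedCohomology` makes the degrees agree.
theorem nonempty_relCohomology_equiv (hX : X ≤ support e) (n : ℕ) :
    Nonempty (relCohomology k (cell e X) (cellBoundary e X) n ≃ₗ[k]
      shiftedReducedCohomology k (cellBoundary e X) n) :=
  nonempty_homology_linearEquiv (fun m => relCochainsEquiv (k := k) hX m) (fun m f => by
    refine (congrArg _ (relCochainComplex_d_apply _ _ m f)).trans ?_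
    refine (relCochainsEquiv_coboundary hX m f).trans ?_
    exact (augmentedCochainComplex_d_apply _ m _).symm) n

end RelativeCohomology

/-! ### The `Ext`-modules between simple modules -/

section ExtModules

variable {k B : Type u} [CommRing k] [LeftRegularBand B] [Finite B] [IsUnital k B]
  {X : SupportSemilattice B} {e : B}

/-- A morphism to a simple module, as a linear map. -/
noncomputable def supportModuleHom {Y : SupportSemilattice B} {n : ℕ}
    (f : (chainResolution k X).complex.X n ⟶ supportModule k Y) :
    SimplicialChains k (contraction X) (n + 1) →ₗ[MonoidAlgebra k B] Isotypic Y k :=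
  f.hom

/-- The morphisms from the resolution to a simple module are the cochains of the boundary of a
cell. -/
noncomputable def resolutionHomEquiv (hX : X ≤ support e) (n : ℕ) :
    ((chainResolution k X).complex.X n ⟶ supportModule k (support e)) ≃ₗ[k]
      (augmentedCochainComplex k (cellBoundary e X)).X n where
  toFun f := homEquivCochain hX n (supportModuleHom f)
  map_add' f g := rfl
  map_smul' r f := by
    funext s
    -- Scalars act on morphisms through the algebra, and the ring homomorphism defining `k_Y`
    -- restricts to the identity on `k`.
    change supportRingHom k (support e) (algebraMap k (MonoidAlgebra k B) r) * _ = r * _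
    rw [Algebra.algebraMap_eq_smul_one, supportRingHom_smul, map_one, mul_one]
    rfl
  invFun g := show ModuleCat.of _ (SimplicialChains k (contraction X) (n + 1)) ⟶
    ModuleCat.of _ (Isotypic (support e) k) from ModuleCat.ofHom ((homEquivCochain hX n).symm g)
  left_inv f := ModuleCat.hom_ext ((homEquivCochain hX n).symm_apply_apply (supportModuleHom f))
  right_inv g := (homEquivCochain hX n).apply_symm_apply g

variable (k) in
theorem nonempty_ext_equiv (hX : X ≤ support e) (n : ℕ) :
    Nonempty (Ext (supportModule k X) (supportModule k (support e)) n ≃ₗ[k]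
      shiftedReducedCohomology k (cellBoundary e X) n) := by
  refine nonempty_ext_linearEquiv_homology (chainResolution k X)
    (augmentedCochainComplex k (cellBoundary e X)) (resolutionHomEquiv hX) (fun m f => ?_) n
  refine Eq.trans ?_ (augmentedCochainComplex_d_apply _ m _).symm
  refine Eq.trans ?_ (homEquivCochain_comp_boundary hX m (supportModuleHom f))
  have h : supportModuleHom ((chainResolution k X).complex.d (m + 1) m ≫ f) =
      (supportModuleHom f).comp (boundaryHom X (m + 1)) :=
    LinearMap.ext fun x => congrArg f.hom (chainComplex_d_apply X m x)
  exact congrArg (homEquivCochain (k := k) hX (m + 1)) h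

variable (k) in
theorem subsingleton_ext_of_not_le {Y : SupportSemilattice B} (hX : ¬ X ≤ Y) (n : ℕ) :
    Subsingleton (Ext (supportModule k X) (supportModule k Y) n) := by
  obtain ⟨e, rfl⟩ := exists_support_eq Y
  exact subsingleton_ext_of_projectiveResolution (chainResolution k X) fun f =>
    ModuleCat.hom_ext (hom_eq_zero hX (supportModuleHom f))

theorem isEmpty_chain_empty {P : Type u} [PartialOrder P] {S : Set P} (hS : S = ∅) {n : ℕ}
    (hn : n ≠ 0) : IsEmpty (Chain S n) := by
  obtain ⟨m, rfl⟩ := Nat.exists_eq_succ_of_ne_zero hn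
  refine ⟨fun s => ?_⟩
  exact hS.subset (s.2.2 0)

variable (k) in
-- For `X = Y` the boundary of the cell is empty, so only the degree of the empty simplex survives;
-- for `X < Y` it is nonempty, so degree 0 vanishes.
theorem ext_equiv_cases {Y : SupportSemilattice B} {e : B} (he : support e = Y) (n : ℕ) :
    (X = Y ∧ n = 0 → Nonempty (Ext (supportModule k X) (supportModule k Y) n ≃ₗ[k] k)) ∧
    (X < Y ∧ 1 ≤ n → Nonempty (Ext (supportModule k X) (supportModule k Y) n ≃ₗ[k]
      shiftedReducedCohomology k (cellBoundary e X) n)) ∧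
    (¬ (X = Y ∧ n = 0) ∧ ¬ (X < Y ∧ 1 ≤ n) →
      Subsingleton (Ext (supportModule k X) (supportModule k Y) n)) := by
  subst he
  refine ⟨?_, fun h => nonempty_ext_equiv k h.1.le n, ?_⟩
  · rintro ⟨rfl, rfl⟩
    obtain ⟨φ⟩ := nonempty_ext_equiv k (le_refl (support e)) 0
    obtain ⟨ψ⟩ := nonempty_shiftedReducedCohomology_empty (k := k)
      (cellBoundary_eq_empty (e := e))
    exact ⟨φ ≪≫ₗ ψ.symm⟩
  · rintro ⟨h1, h2⟩
    by_cases hX : X ≤ support e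
    swap
    · exact subsingleton_ext_of_not_le k hX n
    obtain ⟨φ⟩ := nonempty_ext_equiv k hX n
    suffices Subsingleton (shiftedReducedCohomology k (cellBoundary e X) n) from
      φ.injective.subsingleton
    rcases hX.eq_or_lt with rfl | hlt
    · exact subsingleton_shiftedReducedCohomology_of_isEmpty
        (isEmpty_chain_empty cellBoundary_eq_empty fun hn => h1 ⟨rfl, hn⟩)
    · obtain rfl : n = 0 := by
        by_contra hn
        exact h2 ⟨hlt, Nat.one_le_iff_ne_zero.2 hn⟩
      exact subsingleton_shiftedReducedCohomology_zero (cellBoundary_nonempty hlt)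

end ExtModules

end LRB

/-! ### Reduced cohomology in degree zero and connected components. -/

namespace LRB

/-! ### Connected components and the number of arrows of the quiver -/

section Components

variable {P : Type u} [PartialOrder P] {S : Set P}

/-- A vertex of an order complex, as a chain. -/
def vertexChain (x : S) : Chain S 1 :=
  ⟨fun _ => x.1, Subsingleton.strictMono (α := Fin 1) _, fun _ => x.2⟩

theorem eq_vertexChain (s : Chain S 1) : s = vertexChain ⟨s.1 0, s.2.2 0⟩ :=
  Subtype.ext (funext fun i => by rw [Subsingleton.elim i 0]; rfl)

theorem eq_of_coboundary_eq_zero {k : Type u} [CommRing k] {z : Chain S 1 → k}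
    (hz : coboundary k S 1 z = 0) {x y : S} (h : x.1 < y.1) :
    z (vertexChain x) = z (vertexChain y) := by
  let s : Chain S 2 := ⟨![x.1, y.1], by simpa [Fin.strictMono_iff_lt_succ] using h,
    fun i => by fin_cases i <;> simp⟩
  have h0 : s.face 0 = vertexChain y :=
    (eq_vertexChain _).trans (congrArg vertexChain (Subtype.ext rfl))
  have h1 : s.face 1 = vertexChain x :=
    (eq_vertexChain _).trans (congrArg vertexChain (Subtype.ext rfl))
  have h' : ∑ i : Fin 2, (-1 : k) ^ (i : ℕ) * z (s.face i) = 0 := congrFun hz s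
  rw [Fin.sum_univ_two, h0, h1] at h'
  simp only [Fin.val_zero, pow_zero, one_mul, Fin.val_one, pow_one, neg_mul] at h'
  exact (sub_eq_zero.1 ((sub_eq_add_neg _ _).trans h')).symm

theorem eq_of_reachable {k : Type u} [CommRing k] {z : Chain S 1 → k}
    (hz : coboundary k S 1 z = 0) {x y : S} (h : (comparabilityGraph S).Reachable x y) :
    z (vertexChain x) = z (vertexChain y) := by
  obtain ⟨p⟩ := h
  induction p with
  | nil => rfl
  | @cons x y w hxy _ ih =>
    rw [← ih]
    rcases hxy.2 with h | h
    · exact eq_of_coboundary_eq_zero hz (lt_of_le_of_ne h fun h' => hxy.1 (Subtype.ext h'))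
    · exact (eq_of_coboundary_eq_zero hz
        (lt_of_le_of_ne h fun h' => hxy.1 (Subtype.ext h'.symm))).symm

theorem reachable_of_le {x y : S} (h : x.1 ≤ y.1) : (comparabilityGraph S).Reachable x y := by
  by_cases hxy : x = y
  · rw [hxy]
  · exact SimpleGraph.Adj.reachable ⟨hxy, .inl h⟩

/-- The constant functions on the set of connected components. -/
abbrev constantFunctions (k : Type u) [CommRing k] (S : Set P) :
    Submodule k ((comparabilityGraph S).ConnectedComponent → k) :=
  Submodule.span k {1}

/-- A cocycle on vertices takes equal values at the ends of every edge, so it is a function on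
components; the coboundaries come from the empty simplex and are the constants. -/
theorem nonempty_components_quotient_equiv (k : Type u) [CommRing k] (S : Set P) :
    Nonempty ((((comparabilityGraph S).ConnectedComponent → k) ⧸ constantFunctions k S) ≃ₗ[k]
      shiftedReducedCohomology k S 1) := by
  let K := augmentedCochainComplex k S
  have hcocycle (z : LinearMap.ker (K.d 1 2).hom) : coboundary k S 1 z.1 = 0 :=
    (augmentedCochainComplex_d_apply S 1 z.1).symm.trans z.2
  let restr : LinearMap.ker (K.d 1 2).hom →ₗ[k] ((comparabilityGraph S).ConnectedComponent → k) :=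
    { toFun z c := (z.1 : Chain S 1 → k) (vertexChain c.out)
      map_add' _ _ := rfl
      map_smul' _ _ := rfl }
  have hrestr (z : LinearMap.ker (K.d 1 2).hom) (x : S) :
      restr z ((comparabilityGraph S).connectedComponentMk x) =
        (z.1 : Chain S 1 → k) (vertexChain x) :=
    eq_of_reachable (hcocycle z) (SimpleGraph.ConnectedComponent.exact (Quot.out_eq _))
  refine nonempty_linearEquiv_homology K 1 ((constantFunctions k S).mkQ.comp restr) ?_ ?_
  · refine (Submodule.mkQ_surjective _).comp fun g => ?_
    let z : Chain S 1 → k := fun s =>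
      g ((comparabilityGraph S).connectedComponentMk ⟨s.1 0, s.2.2 0⟩)
    have hz : coboundary k S 1 z = 0 := by
      funext s
      change ∑ i : Fin 2, (-1 : k) ^ (i : ℕ) * z (s.face i) = 0
      have h : z (s.face 0) = z (s.face 1) :=
        congrArg g (SimpleGraph.ConnectedComponent.sound
          (reachable_of_le (s.2.1.monotone (Fin.zero_le 1))).symm)
      rw [Fin.sum_univ_two, h]
      simp
    refine ⟨⟨z, (augmentedCochainComplex_d_apply S 1 z).trans hz⟩, funext fun c => ?_⟩
    exact congrArg g (Quot.out_eq c)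
  · intro z
    have hprev : (ComplexShape.up ℕ).prev 1 = 0 := by simp
    rw [hprev, LinearMap.comp_apply, Submodule.mkQ_apply, Submodule.Quotient.mk_eq_zero,
      Submodule.mem_span_singleton]
    have hd (y : Chain S 0 → k) (s : Chain S 1) : coboundary k S 0 y s = y default := by
      change ∑ i : Fin 1, (-1 : k) ^ (i : ℕ) * y (s.face i) = _
      rw [Fin.sum_univ_one, Fin.val_zero, pow_zero, one_mul]
      exact congrArg y (Subsingleton.elim _ _)
    constructor
    · rintro ⟨r, hr⟩
      refine ⟨fun _ => r, (augmentedCochainComplex_d_apply S 0 _).trans (funext fun s => ?_)⟩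
      rw [hd, eq_vertexChain s, ← hrestr, ← hr]
      simp
    · rintro ⟨y, hy⟩
      have hy' : coboundary k S 0 y = z.1 := (augmentedCochainComplex_d_apply S 0 y).symm.trans hy
      refine ⟨(y : Chain S 0 → k) default, funext fun c => ?_⟩
      have h := (congrFun hy' (vertexChain c.out)).symm.trans (hd y _)
      refine Eq.trans ?_ h.symm
      simp

theorem rank_shiftedReducedCohomology_one (k : Type u) [Field k] [Finite P] (hS : S.Nonempty) :
    Module.rank k (shiftedReducedCohomology k S 1) + 1 = numComponents S := by
  obtain ⟨φ⟩ := nonempty_components_quotient_equiv k S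
  have := Fintype.ofFinite (comparabilityGraph S).ConnectedComponent
  obtain ⟨x, hx⟩ := hS
  have : Nonempty (comparabilityGraph S).ConnectedComponent :=
    ⟨(comparabilityGraph S).connectedComponentMk ⟨x, hx⟩⟩
  have h1 : Module.finrank k (constantFunctions k S) = 1 := finrank_span_singleton one_ne_zero
  have h2 := (constantFunctions k S).finrank_quotient_add_finrank
  rw [h1, Module.finrank_fintype_fun_eq_card] at h2
  rw [← φ.rank_eq, ← Module.finrank_eq_rank, numComponents, Nat.card_eq_fintype_card, ← h2]
  norm_cast

end Components

end LRB

/-! ### Filtrations of arbitrary modules and classification of the simple ones. -/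

namespace LRB

open MonoidAlgebra CategoryTheory.Abelian

/-! ### Filtrations with isotypic quotients -/

section Filtration

variable {k B : Type u} [CommRing k] [LeftRegularBand B] [IsUnital k B]

/-- Extends statements from `B` to `kB`. The module carries no separate `k`-structure, so scalars
pass through `algebraMap`. -/
theorem smul_mem_of_single {M : Type*} [AddCommGroup M] [Module (MonoidAlgebra k B) M]
    {N : AddSubgroup M} (hN : ∀ (r : k), ∀ x ∈ N, algebraMap k (MonoidAlgebra k B) r • x ∈ N)
    {x : M} (h : ∀ b : B, single b (1 : k) • x ∈ N) (a : MonoidAlgebra k B) : a • x ∈ N := by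
  induction a using MonoidAlgebra.induction_linear with
  | zero => simp
  | add a b ha hb =>
    rw [add_smul]
    exact add_mem ha hb
  | single b r =>
    have h' : single b r = algebraMap k (MonoidAlgebra k B) r * single b (1 : k) := by
      rw [algebra_smul_def]
      simp
    rw [h', mul_smul]
    exact hN r _ (h b)

theorem smul_eq_zero_of_single {M : Type*} [AddCommGroup M] [Module (MonoidAlgebra k B) M]
    {x : M} (h : ∀ b : B, single b (1 : k) • x = 0) (a : MonoidAlgebra k B) : a • x = 0 :=
  smul_mem_of_single (N := ⊥) (fun r x hx => by rw [AddSubgroup.mem_bot] at *; rw [hx, smul_zero])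
    h a

theorem single_smul_smul_eq_zero {M : Type*} [AddCommGroup M] [Module (MonoidAlgebra k B) M]
    {x : M} {c : B} (h : ∀ b : B, single c (1 : k) • single b (1 : k) • x = 0)
    (a : MonoidAlgebra k B) : single c (1 : k) • a • x = 0 := by
  have := smul_mem_of_single (k := k)
    (N := (DistribSMul.toAddMonoidHom M (single c (1 : k) : MonoidAlgebra k B)).ker)
    (fun r x hx => ?_) (x := x) h a
  · exact this
  · have hx' : single c (1 : k) • x = 0 := hx
    change single c (1 : k) • algebraMap k (MonoidAlgebra k B) r • x = 0
    rw [smul_smul, ← Algebra.commutes, mul_smul, hx', smul_zero]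

variable (k) in
/-- The elements of the semigroup act on the module as on the simple module of support `X`. -/
def IsIsotypic (X : SupportSemilattice B) (M : Type*) [AddCommGroup M]
    [Module (MonoidAlgebra k B) M] : Prop :=
  ∀ (b : B) (m : M), (X ≤ support b → single b (1 : k) • m = m) ∧
    (¬ X ≤ support b → single b (1 : k) • m = 0)

variable (k B) in
/-- The supports of the elements of the semigroup which do not annihilate the module. -/
def activeSupports (M : Type*) [AddCommGroup M] [Module (MonoidAlgebra k B) M] :
    Set (SupportSemilattice B) :=
  {Y | ∃ b : B, support b = Y ∧ ∃ m : M, single b (1 : k) • m ≠ 0}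

theorem activeSupports_subset_of_injective {M N : Type*} [AddCommGroup M] [AddCommGroup N]
    [Module (MonoidAlgebra k B) M] [Module (MonoidAlgebra k B) N] (f : M →ₗ[MonoidAlgebra k B] N)
    (hf : Function.Injective f) : activeSupports k B M ⊆ activeSupports k B N := by
  rintro _ ⟨b, rfl, m, hm⟩
  refine ⟨b, rfl, f m, ?_⟩
  rw [← map_smul]
  exact (map_ne_zero_iff f hf).2 hm

theorem activeSupports_subset_of_surjective {M N : Type*} [AddCommGroup M] [AddCommGroup N]
    [Module (MonoidAlgebra k B) M] [Module (MonoidAlgebra k B) N] (f : M →ₗ[MonoidAlgebra k B] N)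
    (hf : Function.Surjective f) : activeSupports k B N ⊆ activeSupports k B M := by
  rintro _ ⟨b, rfl, n, hn⟩
  obtain ⟨m, rfl⟩ := hf n
  refine ⟨b, rfl, m, fun h => hn ?_⟩
  rw [← map_smul, h, map_zero]

theorem single_smul_eq_zero_of_notMem {M : Type*} [AddCommGroup M] [Module (MonoidAlgebra k B) M]
    {b : B} (h : support b ∉ activeSupports k B M) (m : M) : single b (1 : k) • m = 0 := by
  by_contra hm
  exact h ⟨b, rfl, m, hm⟩

theorem notMem_activeSupports {M : Type*} [AddCommGroup M] [Module (MonoidAlgebra k B) M]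
    {e : B} (h : ∀ m : M, single e (1 : k) • m = 0) : support e ∉ activeSupports k B M := by
  rintro ⟨b, hb, m, hm⟩
  rw [← mul_eq_of_support_eq hb, ← one_mul (1 : k), ← single_mul_single, mul_smul, h,
    smul_zero] at hm
  exact hm rfl

theorem activeSupports_nonempty {M : Type*} [AddCommGroup M] [Module (MonoidAlgebra k B) M]
    [Nontrivial M] : (activeSupports k B M).Nonempty := by
  by_contra! hempty
  obtain ⟨m, hm⟩ := exists_ne (0 : M)
  refine hm ?_
  rw [← one_smul (MonoidAlgebra k B) m]
  exact smul_eq_zero_of_single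
    (fun b => single_smul_eq_zero_of_notMem (by rw [hempty]; exact Set.notMem_empty _) m) 1

/-- The elements generating a submodule annihilated by `e`. -/
noncomputable def annihilatedBy (e : B) (M : Type*) [AddCommGroup M] [Module (MonoidAlgebra k B) M] :
    Submodule (MonoidAlgebra k B) M where
  carrier := {m | ∀ a : MonoidAlgebra k B, single e (1 : k) • a • m = 0}
  zero_mem' a := by simp
  add_mem' hx hy a := by rw [smul_add, smul_add, hx, hy, add_zero]
  smul_mem' c x hx a := by
    rw [← mul_smul a c x]
    exact hx _

variable (k) in
/-- The submodule generated by the multiples of `e`. -/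
noncomputable def generatedBy (e : B) (M : Type*) [AddCommGroup M] [Module (MonoidAlgebra k B) M] :
    Submodule (MonoidAlgebra k B) M :=
  Submodule.span _ (Set.range fun m : M => single e (1 : k) • m)

/-- If `be` acts nontrivially, minimality gives `support e ≤ support (be) ≤ support b`. General
elements `a e m` reduce to this because `bc` has support below that of `b`. -/
theorem single_smul_eq_zero_of_mem_generatedBy {M : Type*} [AddCommGroup M]
    [Module (MonoidAlgebra k B) M] {e : B}
    (he : Minimal (· ∈ activeSupports k B M) (support e)) {m : M} (hm : m ∈ generatedBy k e M) :
    ∀ b : B, ¬ support e ≤ support b → single b (1 : k) • m = 0 := by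
  induction hm using Submodule.span_induction with
  | mem m hm =>
    intro b hb
    obtain ⟨m, rfl⟩ := hm
    dsimp only
    rw [smul_smul, single_mul_single, one_mul]
    refine single_smul_eq_zero_of_notMem (fun h => hb ?_) m
    exact (he.2 h (support_mul_le_right b e)).trans (support_mul_le_left b e)
  | zero => exact fun b _ => smul_zero _
  | add x y _ _ hx hy =>
    intro b hb
    rw [smul_add, hx b hb, hy b hb, add_zero]
  | smul a x _ h =>
    intro b hb
    refine single_smul_smul_eq_zero (fun c => ?_) a
    rw [smul_smul, single_mul_single, one_mul]
    exact h _ fun h' => hb (h'.trans (support_mul_le_left b c))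

/-- For `c` of support at least that of `e`, both `ecb` and `ec` equal `e`, so `ec` kills `bm - m`;
every other `c` kills the module. -/
theorem single_smul_sub_mem_annihilatedBy {M : Type*} [AddCommGroup M]
    [Module (MonoidAlgebra k B) M] {e : B}
    (h : ∀ b : B, ¬ support e ≤ support b → ∀ m : M, single b (1 : k) • m = 0) {b : B}
    (hb : support e ≤ support b) (m : M) : single b (1 : k) • m - m ∈ annihilatedBy (k := k) e M := by
  refine single_smul_smul_eq_zero fun c => ?_
  by_cases hc : support e ≤ support c
  · rw [smul_smul, single_mul_single, support_le.1 hc, smul_sub, smul_smul, single_mul_single,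
      support_le.1 hb]
    simp
  · rw [h c hc, smul_zero]

theorem isIsotypic_quotient_annihilatedBy {M : Type*} [AddCommGroup M]
    [Module (MonoidAlgebra k B) M] {e : B}
    (h : ∀ b : B, ¬ support e ≤ support b → ∀ m : M, single b (1 : k) • m = 0) :
    IsIsotypic k (support e) (M ⧸ annihilatedBy (k := k) e M) := by
  intro b m
  obtain ⟨m, rfl⟩ := Submodule.mkQ_surjective _ m
  refine ⟨fun hb => ?_, fun hb => ?_⟩
  · rw [← map_smul, ← sub_eq_zero, ← map_sub, Submodule.mkQ_apply, Submodule.Quotient.mk_eq_zero]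
    exact single_smul_sub_mem_annihilatedBy h hb m
  · rw [← map_smul, h b hb, map_zero]

/-- A property of modules over the semigroup algebra that is stable under extensions and holds
for the isotypic modules holds for all modules. -/
theorem isotypic_induction [Finite B] {p : ModuleCat.{u} (MonoidAlgebra k B) → Prop}
    (hext : ∀ {M N : Type u} [AddCommGroup M] [AddCommGroup N] [Module (MonoidAlgebra k B) M]
      [Module (MonoidAlgebra k B) N] (f : M →ₗ[MonoidAlgebra k B] N), Function.Surjective f →
      p (ModuleCat.of _ (LinearMap.ker f)) → p (ModuleCat.of _ N) → p (ModuleCat.of _ M))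
    (hiso : ∀ (X : SupportSemilattice B) {M : Type u} [AddCommGroup M]
      [Module (MonoidAlgebra k B) M], IsIsotypic k X M → p (ModuleCat.of _ M)) [Nonempty B]
    (M : Type u) [AddCommGroup M] [Module (MonoidAlgebra k B) M] : p (ModuleCat.of _ M) := by
  obtain ⟨n, hn⟩ : ∃ n, (activeSupports k B M).ncard = n := ⟨_, rfl⟩
  induction n using Nat.strong_induction_on generalizing M with
  | _ n ih =>
    -- A subquotient annihilated by `e` loses the support of `e` from its active supports, so the
    -- induction hypothesis applies.
    have key (N : Type u) [AddCommGroup N] [Module (MonoidAlgebra k B) N] {e : B}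
        (hsub : activeSupports k B N ⊆ activeSupports k B M)
        (he : support e ∈ activeSupports k B M) (hN : ∀ m : N, single e (1 : k) • m = 0) :
        p (ModuleCat.of _ N) := by
      refine ih _ ?_ N rfl
      rw [← hn]
      exact Set.ncard_lt_ncard (hsub.ssubset_of_mem_notMem he (notMem_activeSupports hN))
    rcases subsingleton_or_nontrivial M with hM | hM
    · exact hiso (support (Classical.arbitrary B)) fun b m =>
        ⟨fun _ => Subsingleton.elim _ _, fun _ => Subsingleton.elim _ _⟩
    obtain ⟨Y, hY⟩ := (activeSupports k B M).toFinite.exists_minimal activeSupports_nonempty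
    obtain ⟨e, rfl⟩ := exists_support_eq Y
    -- With `W` generated by `eM`, the layers are `M/W` and the largest submodule of `W` annihilated
    -- by `e`, both covered by induction, and between them an isotypic quotient of `W`.
    refine hext (generatedBy k e M).mkQ (Submodule.mkQ_surjective _) ?_ ?_
    · let W := LinearMap.ker (generatedBy k e M).mkQ
      have hW (b : B) (hb : ¬ support e ≤ support b) (w : W) : single b (1 : k) • w = 0 := by
        exact Subtype.ext (single_smul_eq_zero_of_mem_generatedBy hY
          ((Submodule.ker_mkQ (generatedBy k e M)).le w.2) b hb)
      have hsub : activeSupports k B W ⊆ activeSupports k B M :=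
        activeSupports_subset_of_injective W.subtype W.injective_subtype
      refine hext (annihilatedBy (k := k) e W).mkQ (Submodule.mkQ_surjective _) ?_
        (hiso (support e) (isIsotypic_quotient_annihilatedBy hW))
      refine key _ ((activeSupports_subset_of_injective _ (Submodule.injective_subtype _)).trans
        hsub) hY.1 fun m => Subtype.ext ?_
      have h := (Submodule.ker_mkQ (annihilatedBy (k := k) e W)).le m.2 1
      rwa [one_smul] at h
    · refine key _ (activeSupports_subset_of_surjective _ (Submodule.mkQ_surjective _)) hY.1
        fun m => ?_
      obtain ⟨m, rfl⟩ := Submodule.mkQ_surjective _ m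
      rw [← map_smul, Submodule.mkQ_apply, Submodule.Quotient.mk_eq_zero]
      exact Submodule.subset_span ⟨m, rfl⟩

end Filtration

/-! ### The simple modules -/

section Simple

variable {B : Type u} [LeftRegularBand B]

theorem isIsotypic_isotypic {k : Type u} [CommRing k] [IsUnital k B] (X : SupportSemilattice B)
    (V : Type*) [AddCommGroup V] [Module k V] : IsIsotypic k X (Isotypic X V) :=
  fun _ v => ⟨fun h => single_smul_isotypic_of_le h v, fun h => single_smul_isotypic_of_not h v⟩

/-- A `k`-linear map between isotypic modules with the same support is linear over the semigroup
algebra. -/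
noncomputable def isotypicLinearMap {k : Type u} [CommRing k] [IsUnital k B]
    {X : SupportSemilattice B} {M N : Type*} [AddCommGroup M]
    [AddCommGroup N] [Module k M] [Module k N] [Module (MonoidAlgebra k B) M]
    [Module (MonoidAlgebra k B) N] [IsScalarTower k (MonoidAlgebra k B) M]
    [IsScalarTower k (MonoidAlgebra k B) N] (hM : IsIsotypic k X M) (hN : IsIsotypic k X N)
    (f : M →ₗ[k] N) : M →ₗ[MonoidAlgebra k B] N :=
  linearMapOfEquivariant f fun b m => by
    by_cases h : X ≤ support b
    · rw [(hM b m).1 h, (hN b _).1 h]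
    · rw [(hM b m).2 h, (hN b _).2 h, map_zero]

variable {k : Type u} [Field k] [IsUnital k B]

instance isSimpleModule_isotypic (X : SupportSemilattice B) :
    IsSimpleModule (MonoidAlgebra k B) (Isotypic X k) := by
  rw [isSimpleModule_iff_toSpanSingleton_surjective]
  refine ⟨inferInstanceAs (Nontrivial k), fun r hr s =>
    ⟨algebraMap k _ (isotypicVal s * (isotypicVal r)⁻¹), ?_⟩⟩
  rw [LinearMap.toSpanSingleton_apply, algebraMap_smul]
  exact inv_mul_cancel_right₀ (G₀ := k) hr s

theorem simple_supportModule (X : SupportSemilattice B) : Simple (supportModule k X) := by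
  rw [supportModule_eq, simple_iff_isSimpleModule]
  infer_instance

/-- For `e` of minimal active support, simplicity collapses the filtration: the multiples of `e`
generate everything and the part annihilated by `e` is zero. -/
theorem exists_isIsotypic_of_isSimpleModule [Finite B] {M : Type*} [AddCommGroup M]
    [Module (MonoidAlgebra k B) M] [IsSimpleModule (MonoidAlgebra k B) M] :
    ∃ X : SupportSemilattice B, IsIsotypic k X M := by
  have := IsSimpleModule.nontrivial (MonoidAlgebra k B) M
  obtain ⟨Y, hY⟩ := (activeSupports k B M).toFinite.exists_minimal activeSupports_nonempty
  obtain ⟨e, rfl⟩ := exists_support_eq Y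
  obtain ⟨m, hm⟩ : ∃ m : M, single e (1 : k) • m ≠ 0 := by
    by_contra! h
    exact notMem_activeSupports h hY.1
  have hgen : generatedBy k e M = ⊤ := by
    refine (eq_bot_or_eq_top _).resolve_left fun h => hm ?_
    rw [← Submodule.mem_bot (MonoidAlgebra k B), ← h]
    exact Submodule.subset_span ⟨m, rfl⟩
  have hann : annihilatedBy (k := k) e M = ⊥ := by
    refine (eq_bot_or_eq_top _).resolve_right fun h => hm ?_
    have h' : m ∈ annihilatedBy (k := k) e M := by rw [h]; trivial
    have h1 := h' 1
    rwa [one_smul] at h1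
  have hzero (b : B) (hb : ¬ support e ≤ support b) (m : M) : single b (1 : k) • m = 0 :=
    single_smul_eq_zero_of_mem_generatedBy hY (by rw [hgen]; trivial) b hb
  refine ⟨support e, fun b m => ⟨fun hb => ?_, fun hb => hzero b hb m⟩⟩
  have h := single_smul_sub_mem_annihilatedBy hzero hb m
  rwa [hann, Submodule.mem_bot, sub_eq_zero] at h

theorem le_of_isIsotypic {X Y : SupportSemilattice B} {M : Type*} [AddCommGroup M] [Nontrivial M]
    [Module (MonoidAlgebra k B) M] (hX : IsIsotypic k X M) (hY : IsIsotypic k Y M) : X ≤ Y := by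
  obtain ⟨b, rfl⟩ := exists_support_eq Y
  obtain ⟨m, hm⟩ := exists_ne (0 : M)
  by_contra h
  exact hm (((hY b m).1 le_rfl).symm.trans ((hX b m).2 h))

theorem existsUnique_supportModule [Finite B] (S : ModuleCat.{u} (MonoidAlgebra k B))
    (hS : Simple S) : ∃! X : SupportSemilattice B, Nonempty (S ≅ supportModule k X) := by
  have hS' : IsSimpleModule (MonoidAlgebra k B) S := (simple_iff_isSimpleModule' S).1 hS
  have := IsSimpleModule.nontrivial (MonoidAlgebra k B) S
  obtain ⟨X, hX⟩ := exists_isIsotypic_of_isSimpleModule (k := k) (B := B) (M := S)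
  refine ⟨X, ?_, ?_⟩
  · let : Module k S := Module.restrictScalars k (MonoidAlgebra k B) S
    have : IsScalarTower k (MonoidAlgebra k B) S :=
      IsScalarTower.restrictScalars k (MonoidAlgebra k B) S
    obtain ⟨m, hm⟩ := exists_ne (0 : S)
    let f₀ : Isotypic X k →ₗ[k] S := LinearMap.toSpanSingleton k S m
    let f : Isotypic X k →ₗ[MonoidAlgebra k B] S :=
      isotypicLinearMap (isIsotypic_isotypic X k) hX f₀
    have hf : f ≠ 0 := by
      intro h
      have h1 : LinearMap.toSpanSingleton k S m 1 = 0 := LinearMap.congr_fun h (1 : k)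
      rw [LinearMap.toSpanSingleton_apply, one_smul] at h1
      exact hm h1
    exact ⟨(LinearEquiv.ofBijective f (LinearMap.bijective_of_ne_zero hf)).symm.toModuleIso⟩
  · rintro Y ⟨φ⟩
    have hY : IsIsotypic k Y S := by
      intro b m
      have h := isIsotypic_isotypic (k := k) Y k b (φ.toLinearEquiv m)
      refine ⟨fun hb => φ.toLinearEquiv.injective ?_, fun hb => φ.toLinearEquiv.injective ?_⟩
      · rw [map_smul]
        exact h.1 hb
      · rw [map_smul, map_zero]
        exact h.2 hb
    exact le_antisymm (le_of_isIsotypic hY hX) (le_of_isIsotypic hX hY)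

end Simple

end LRB

/-! ### Projective dimension, global dimension and the quiver. -/

namespace LRB

open MonoidAlgebra CategoryTheory.Abelian

/-! ### Projective dimensions -/

theorem hasProjectiveDimensionLT_of_surjective {A : Type u} [Ring A] {M N : Type u}
    [AddCommGroup M] [AddCommGroup N] [Module A M] [Module A N] (f : M →ₗ[A] N)
    (hf : Function.Surjective f) {n : ℕ}
    (h₁ : HasProjectiveDimensionLT (ModuleCat.of A (LinearMap.ker f)) n)
    (h₃ : HasProjectiveDimensionLT (ModuleCat.of A N) n) :
    HasProjectiveDimensionLT (ModuleCat.of A M) n :=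
  (LinearMap.shortExact_shortComplexKer hf).hasProjectiveDimensionLT_X₂ n h₁ h₃

theorem subsingleton_ext_of_surjective {A : Type u} [Ring A] {X : ModuleCat.{u} A} {M N : Type u}
    [AddCommGroup M] [AddCommGroup N] [Module A M] [Module A N] (f : M →ₗ[A] N)
    (hf : Function.Surjective f) {n : ℕ}
    (h₁ : Subsingleton (Ext X (ModuleCat.of A (LinearMap.ker f)) n))
    (h₃ : Subsingleton (Ext X (ModuleCat.of A N) n)) :
    Subsingleton (Ext X (ModuleCat.of A M) n) := by
  refine subsingleton_of_forall_eq 0 fun α => ?_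
  obtain ⟨β, rfl⟩ := Ext.covariant_sequence_exact₂ X (LinearMap.shortExact_shortComplexKer hf) α
    (h₃.elim _ _)
  rw [h₁.elim β 0, Ext.zero_comp]

theorem nonempty_finsupp_ker_iso {A : Type u} [Ring A] (I : Type u) {M N : Type u}
    [AddCommGroup M] [AddCommGroup N] [Module A M] [Module A N] (f : M →ₗ[A] N) :
    Nonempty (ModuleCat.of A (I →₀ LinearMap.ker f) ≅
      ModuleCat.of A (LinearMap.ker (Finsupp.mapRange.linearMap (α := I) f))) := by
  let φ : (I →₀ LinearMap.ker f) →ₗ[A] LinearMap.ker (Finsupp.mapRange.linearMap (α := I) f) :=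
    (Finsupp.mapRange.linearMap (Submodule.subtype _)).codRestrict _ fun x => by
      rw [LinearMap.mem_ker]
      ext i : 1
      exact (x i).2
  have hφ : Function.Bijective φ := by
    constructor
    · intro x y hxy
      exact Finsupp.mapRange_injective _ rfl Subtype.val_injective (congrArg Subtype.val hxy)
    · intro x
      have hx (i : I) : f (x.1 i) = 0 := DFunLike.congr_fun x.2 i
      refine ⟨Finsupp.onFinset x.1.support (fun i => ⟨x.1 i, hx i⟩) fun i hi => ?_,
        Subtype.ext (Finsupp.ext fun i => rfl)⟩
      rw [Finsupp.mem_support_iff]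
      exact fun h0 => hi (Subtype.ext h0)
  exact ⟨(LinearEquiv.ofBijective φ hφ).toModuleIso⟩

/-- Induction by dimension shifting: a direct sum of copies of a free cover of `M` is a free cover
of the direct sum, and its kernel is the direct sum of the kernels. The bounds 0 and 1 mean zero and
projective modules. -/
theorem hasProjectiveDimensionLT_finsupp {A : Type u} [Ring A] (I : Type u) (n : ℕ) :
    ∀ (M : Type u) [AddCommGroup M] [Module A M], HasProjectiveDimensionLT (ModuleCat.of A M) n →
      HasProjectiveDimensionLT (ModuleCat.of A (I →₀ M)) n := by
  match n with
  | 0 =>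
    intro M _ _ h
    rw [hasProjectiveDimensionLT_zero_iff_isZero, ModuleCat.isZero_iff_subsingleton] at *
    have : Subsingleton M := h
    exact inferInstanceAs (Subsingleton (I →₀ M))
  | 1 =>
    intro M _ _ h
    have : Module.Projective A M :=
      (IsProjective.iff_projective _).2 (projective_iff_hasProjectiveDimensionLT_one.2 h)
    have hI : Module.Projective A (I →₀ M) := by
      classical
      exact Module.Projective.of_equiv (finsuppLequivDFinsupp A).symm
    exact projective_iff_hasProjectiveDimensionLT_one.1
      ((IsProjective.iff_projective (I →₀ M)).1 hI)
  | n + 2 =>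
    intro M _ _ h
    have hf : Function.Surjective (Finsupp.linearCombination A (id : M → M)) :=
      Finsupp.linearCombination_id_surjective A M
    have hg : Function.Surjective
        (Finsupp.mapRange.linearMap (α := I) (Finsupp.linearCombination A (id : M → M))) :=
      Finsupp.mapRange_surjective _ (map_zero _) hf
    have hp : Module.Projective A (I →₀ M →₀ A) := inferInstance
    refine ((LinearMap.shortExact_shortComplexKer hg).hasProjectiveDimensionLT_X₃_iff n
      ((IsProjective.iff_projective (I →₀ M →₀ A)).1 hp)).2 ?_
    have h' := ((LinearMap.shortExact_shortComplexKer hf).hasProjectiveDimensionLT_X₃_iff n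
      ((IsProjective.iff_projective (M →₀ A)).1 inferInstance)).1 h
    have h'' := hasProjectiveDimensionLT_finsupp I (n + 1) _ h'
    exact hasProjectiveDimensionLT_of_iso (nonempty_finsupp_ker_iso I _).some _

section Isotypic

variable {k B : Type u} [Field k] [LeftRegularBand B] [IsUnital k B]

/-- An isotypic module is a direct sum of simple modules. -/
theorem exists_isotypic_linearEquiv {X : SupportSemilattice B} {M : Type u} [AddCommGroup M]
    [Module (MonoidAlgebra k B) M] (hM : IsIsotypic k X M) :
    ∃ I : Type u, Nonempty ((I →₀ Isotypic X k) ≃ₗ[MonoidAlgebra k B] M) := by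
  let : Module k M := Module.restrictScalars k (MonoidAlgebra k B) M
  have : IsScalarTower k (MonoidAlgebra k B) M :=
    IsScalarTower.restrictScalars k (MonoidAlgebra k B) M
  let b := Module.Basis.ofVectorSpace k M
  let ι : Type u := Module.Basis.ofVectorSpaceIndex k M
  have hI : IsIsotypic k X (ι →₀ Isotypic X k) := fun c x =>
    ⟨fun h => Finsupp.ext fun i => single_smul_isotypic_of_le h (x i),
      fun h => Finsupp.ext fun i => single_smul_isotypic_of_not h (x i)⟩
  let f : (ι →₀ Isotypic X k) →ₗ[k] M := b.repr.symm.toLinearMap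
  exact ⟨ι, ⟨LinearEquiv.ofBijective (isotypicLinearMap hI hM f) b.repr.symm.bijective⟩⟩

/-- A cocycle is trivialised in each coordinate separately. Since the source is finitely generated,
only finitely many coordinates occur and the trivialisations can be added. -/
theorem subsingleton_ext_succ_finsupp {A : Type u} [Ring A] {X : ModuleCat.{u} A}
    (R : ProjectiveResolution X) (I : Type u) {V : Type u} [AddCommGroup V] [Module A V] {n : ℕ}
    [Module.Finite A (R.complex.X (n + 1))]
    (h : Subsingleton (Ext X (ModuleCat.of A V) (n + 1))) :
    Subsingleton (Ext X (ModuleCat.of A (I →₀ V)) (n + 1)) := by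
  classical
  refine subsingleton_ext_succ_of_projectiveResolution R fun f hf => ?_
  let π (i : I) : ModuleCat.of A (I →₀ V) ⟶ ModuleCat.of A V := ModuleCat.ofHom (Finsupp.lapply i)
  let κ (i : I) : ModuleCat.of A V ⟶ ModuleCat.of A (I →₀ V) := ModuleCat.ofHom (Finsupp.lsingle i)
  have hg (i : I) : ∃ g : R.complex.X n ⟶ ModuleCat.of A V,
      R.complex.d (n + 1) n ≫ g = f ≫ π i := by
    have hfi : R.complex.d (n + 2) (n + 1) ≫ f ≫ π i = 0 := by
      rw [← Category.assoc, hf, Limits.zero_comp]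
    exact (R.extMk_eq_zero_iff _ (n + 2) rfl hfi n rfl).1 (h.elim _ _)
  choose g hg using hg
  obtain ⟨G, hG⟩ := Module.Finite.fg_top (R := A) (M := R.complex.X (n + 1))
  let F : Finset I := G.biUnion fun x => (f.hom x : I →₀ V).support
  refine ⟨∑ i ∈ F, g i ≫ κ i, ?_⟩
  rw [Preadditive.comp_sum]
  simp only [← Category.assoc, hg]
  refine ModuleCat.hom_ext (LinearMap.ext_on hG fun x hx => ?_)
  rw [ModuleCat.hom_sum, LinearMap.sum_apply]
  have hsub : (f.hom x : I →₀ V).support ⊆ F :=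
    Finset.subset_biUnion_of_mem (fun x => (f.hom x : I →₀ V).support) hx
  refine Eq.trans ?_ (Finsupp.sum_single (f.hom x : I →₀ V))
  exact (Finset.sum_subset hsub fun i _ hi => by
    change Finsupp.single i ((f.hom x : I →₀ V) i) = 0
    rw [Finsupp.notMem_support_iff.1 hi, Finsupp.single_zero]).symm

end Isotypic

section GlobalDimension

variable {k B : Type u} [Field k] [LeftRegularBand B] [Finite B] [Nonempty B] [IsUnital k B]

instance finite_chainResolution (X : SupportSemilattice B) (n : ℕ) :
    Module.Finite (MonoidAlgebra k B) ((chainResolution k X).complex.X n) := by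
  have : Module.Finite k (SimplicialChains k (contraction X) (n + 1)) :=
    inferInstanceAs (Module.Finite k (Chain (contraction X) (n + 1) →₀ k))
  exact Module.Finite.of_restrictScalars_finite k (MonoidAlgebra k B)
    (SimplicialChains k (contraction X) (n + 1))

theorem subsingleton_ext_of_supportModule {X : SupportSemilattice B} {n : ℕ}
    (h : ∀ Y, Subsingleton (Ext (supportModule k X) (supportModule k Y) (n + 1)))
    (M : ModuleCat.{u} (MonoidAlgebra k B)) : Subsingleton (Ext (supportModule k X) M (n + 1)) := by
  refine isotypic_induction (k := k) (B := B)
    (p := fun M => Subsingleton (Ext (supportModule k X) M (n + 1)))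
    (fun f hf h₁ h₃ => subsingleton_ext_of_surjective f hf h₁ h₃) (fun Y M _ _ hM => ?_) M
  obtain ⟨I, ⟨φ⟩⟩ := exists_isotypic_linearEquiv hM
  have := subsingleton_ext_succ_finsupp (chainResolution k X) I (V := Isotypic Y k) (h Y)
  refine subsingleton_of_forall_eq 0 fun α => ?_
  obtain ⟨ψ⟩ : Nonempty (ModuleCat.of _ (I →₀ Isotypic Y k) ≅ ModuleCat.of _ M) := ⟨φ.toModuleIso⟩
  have h0 : α.comp (Ext.mk₀ ψ.inv) (add_zero (n + 1)) = 0 := Subsingleton.elim _ _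
  have h1 := congrArg (fun β => β.comp (Ext.mk₀ ψ.hom) (add_zero (n + 1))) h0
  simpa using h1

/-- Filtering the second argument of `Ext` by isotypic modules bounds the projective dimension of
each `k_X`; filtering an arbitrary module then bounds its own. -/
theorem hasProjectiveDimensionLT_of_ext {n : ℕ}
    (h : ∀ (X Y : SupportSemilattice B) (m : ℕ), n < m →
      Subsingleton (Ext (supportModule k X) (supportModule k Y) m))
    (M : ModuleCat.{u} (MonoidAlgebra k B)) : HasProjectiveDimensionLT M (n + 1) := by
  refine isotypic_induction (k := k) (B := B) (p := fun M => HasProjectiveDimensionLT M (n + 1))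
    (fun f hf h₁ h₃ => hasProjectiveDimensionLT_of_surjective f hf h₁ h₃) (fun X M _ _ hM => ?_) M
  obtain ⟨I, ⟨φ⟩⟩ := exists_isotypic_linearEquiv hM
  have hX : HasProjectiveDimensionLT (supportModule k X) (n + 1) := by
    rw [hasProjectiveDimensionLT_iff]
    intro i hi Y α
    obtain ⟨j, rfl⟩ : ∃ j, i = j + 1 := ⟨i - 1, by lia⟩
    exact (subsingleton_ext_of_supportModule (fun Y => h X Y (j + 1) (by lia)) Y).elim _ _
  have := hasProjectiveDimensionLT_finsupp I (n + 1) (Isotypic X k) hX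
  exact hasProjectiveDimensionLT_of_iso φ.toModuleIso _

theorem isEmpty_chain {P : Type u} [PartialOrder P] [Finite P] (S : Set P) {n : ℕ}
    (h : Nat.card P < n) : IsEmpty (Chain S n) := by
  refine ⟨fun s => ?_⟩
  have := Nat.card_le_card_of_injective _ s.2.1.injective
  rw [Nat.card_fin] at this
  lia

/-- The set of degrees contains 0, from the empty boundary when `X = Y`, and is bounded by the
number of elements of `B`. Its maximum bounds all projective dimensions, and it is attained at the
`k_X` whose `Ext` is nonzero there. -/
theorem exists_globalDimension_eq {e : SupportSemilattice B → B} (he : ∀ Y, support (e Y) = Y) :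
    ∃ d : ℕ, globalDimension (MonoidAlgebra k B) = ((d : ℕ∞) : WithBot ℕ∞) ∧
      IsGreatest {n : ℕ | ∃ X Y : SupportSemilattice B, X ≤ Y ∧
        Nontrivial (shiftedReducedCohomology k (cellBoundary (e Y) X) n)} d := by
  let T : Set ℕ := {n : ℕ | ∃ X Y : SupportSemilattice B, X ≤ Y ∧
    Nontrivial (shiftedReducedCohomology k (cellBoundary (e Y) X) n)}
  have hext {X Y : SupportSemilattice B} (hXY : X ≤ Y) (n : ℕ) :
      Nonempty (Ext (supportModule k X) (supportModule k Y) n ≃ₗ[k]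
        shiftedReducedCohomology k (cellBoundary (e Y) X) n) := by
    have h := nonempty_ext_equiv k (hXY.trans (he Y).ge) n
    rwa [he] at h
  have hne : T.Nonempty := by
    let Y := support (Classical.arbitrary B)
    have hY : cellBoundary (e Y) Y = ∅ := by
      have := cellBoundary_eq_empty (e := e Y)
      rwa [he] at this
    obtain ⟨φ⟩ := nonempty_shiftedReducedCohomology_empty (k := k) hY
    exact ⟨0, Y, Y, le_rfl, φ.symm.toEquiv.nontrivial⟩
  have hbdd : BddAbove T := by
    refine ⟨Nat.card B, ?_⟩
    rintro n ⟨X, Y, -, hn⟩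
    by_contra! hlt
    have := subsingleton_shiftedReducedCohomology_of_isEmpty (k := k)
      (isEmpty_chain (cellBoundary (e Y) X) hlt)
    exact not_subsingleton _ this
  have hd : IsGreatest T (sSup T) := ⟨Nat.sSup_mem hne hbdd, fun n hn => le_csSup hbdd hn⟩
  refine ⟨sSup T, le_antisymm (iSup_le fun M => ?_) ?_, hd⟩
  · refine (projectiveDimension_le_iff M _).2 (hasProjectiveDimensionLT_of_ext (k := k) (B := B) ?_ M)
    intro X Y m hm
    by_cases hXY : X ≤ Y
    · obtain ⟨φ⟩ := hext hXY m
      by_contra hnt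
      rw [not_subsingleton_iff_nontrivial] at hnt
      exact hm.not_ge (hd.2 ⟨X, Y, hXY, φ.symm.toEquiv.nontrivial⟩)
    · exact subsingleton_ext_of_not_le k hXY m
  · obtain ⟨X, Y, hXY, hnt⟩ := hd.1
    refine le_trans ?_ (le_iSup _ (supportModule k X))
    refine (projectiveDimension_ge_iff _ _).2 fun h => ?_
    obtain ⟨φ⟩ := hext hXY (sSup T)
    have := HasProjectiveDimensionLT.subsingleton (supportModule k X) (sSup T) (sSup T) le_rfl
      (supportModule k Y)
    exact not_subsingleton _ φ.symm.toEquiv.subsingleton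

end GlobalDimension

/-! ### The quiver -/

section Quiver

variable {B : Type u} (k : Type u) [Field k] [LeftRegularBand B] [Finite B] [IsUnital k B]

theorem quiverArrows_add_one {e : B} {X Y : SupportSemilattice B} (he : support e = Y)
    (h : X < Y) : quiverArrows k (supportModule k X) (supportModule k Y) + 1 =
      numComponents (cellBoundary e X) := by
  subst he
  obtain ⟨φ⟩ := nonempty_ext_equiv k h.le 1
  rw [← rank_shiftedReducedCohomology_one k (cellBoundary_nonempty h), ← φ.rank_eq]
  rfl

theorem quiverArrows_eq_zero {e : B} {X Y : SupportSemilattice B} (he : support e = Y)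
    (h : ¬ X < Y) : quiverArrows k (supportModule k X) (supportModule k Y) = 0 := by
  have : Subsingleton (Ext (supportModule k X) (supportModule k Y) 1) :=
    (ext_equiv_cases k he 1).2.2 ⟨fun h' => one_ne_zero h'.2, fun h' => h h'.1⟩
  exact rank_subsingleton' k _

end Quiver

end LRB

/-! ### The main theorem. -/

theorem theoremt {k B : Type u} [CommRing k] [LeftRegularBand B] [Finite B] [Nonempty B]
    (hB : LRB.IsConnected B)
    (e : LRB.SupportSemilattice B → B) (he : ∀ Y, LRB.leftIdeal (e Y) = Y.1) :
    ∃ _ : LRB.IsUnital k B,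
      -- the Ext modules as relative cohomology
      (∀ (X Y : LRB.SupportSemilattice B) (n : ℕ),
        (X ≤ Y → Nonempty
          (CategoryTheory.Abelian.Ext (LRB.supportModule k X) (LRB.supportModule k Y) n ≃ₗ[k]
            LRB.relCohomology k (LRB.cell (e Y) X) (LRB.cellBoundary (e Y) X) n)) ∧
        (¬ X ≤ Y → Subsingleton
          (CategoryTheory.Abelian.Ext (LRB.supportModule k X) (LRB.supportModule k Y) n))) ∧
      -- the Ext modules as reduced cohomology
      (∀ (X Y : LRB.SupportSemilattice B) (n : ℕ),
        (X = Y ∧ n = 0 → Nonempty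
          (CategoryTheory.Abelian.Ext (LRB.supportModule k X) (LRB.supportModule k Y) n ≃ₗ[k] k)) ∧
        (X < Y ∧ 1 ≤ n → Nonempty
          (CategoryTheory.Abelian.Ext (LRB.supportModule k X) (LRB.supportModule k Y) n ≃ₗ[k]
            LRB.shiftedReducedCohomology k (LRB.cellBoundary (e Y) X) n)) ∧
        (¬ (X = Y ∧ n = 0) ∧ ¬ (X < Y ∧ 1 ≤ n) → Subsingleton
          (CategoryTheory.Abelian.Ext (LRB.supportModule k X) (LRB.supportModule k Y) n))) ∧
      -- the quiver, over a field: its vertices and its arrows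
      (IsField k →
        (∀ X : LRB.SupportSemilattice B, CategoryTheory.Simple (LRB.supportModule k X)) ∧
        (∀ S : ModuleCat.{u} (MonoidAlgebra k B), CategoryTheory.Simple S →
          ∃! X : LRB.SupportSemilattice B, Nonempty (S ≅ LRB.supportModule k X)) ∧
        (∀ X Y : LRB.SupportSemilattice B,
          (X < Y → LRB.quiverArrows k (LRB.supportModule k X) (LRB.supportModule k Y) + 1 =
            LRB.numComponents (LRB.cellBoundary (e Y) X)) ∧
          (¬ X < Y → LRB.quiverArrows k (LRB.supportModule k X) (LRB.supportModule k Y) = 0))) ∧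
      -- the global dimension, over a field
      (IsField k → ∃ d : ℕ,
        LRB.globalDimension (MonoidAlgebra k B) = ((d : ℕ∞) : WithBot ℕ∞) ∧
        IsGreatest {n : ℕ | ∃ X Y : LRB.SupportSemilattice B, X ≤ Y ∧
          Nontrivial (LRB.shiftedReducedCohomology k (LRB.cellBoundary (e Y) X) n)} d) := by
  have he' (Y : LRB.SupportSemilattice B) : LRB.support (e Y) = Y :=
    LRB.support_eq_of_leftIdeal (he Y)
  have hu := LRB.isUnital_of_isConnected k hB
  refine ⟨hu, fun X Y n => ⟨fun h => ?_,
    fun h => LRB.subsingleton_ext_of_not_le k h n⟩, fun X Y n => LRB.ext_equiv_cases k (he' Y) n,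
    fun hk => ?_, fun hk => ?_⟩
  · have hX : X ≤ LRB.support (e Y) := h.trans (he' Y).ge
    obtain ⟨φ⟩ := LRB.nonempty_ext_equiv k hX n
    obtain ⟨ψ⟩ := LRB.nonempty_relCohomology_equiv k hX n
    rw [he'] at φ
    exact ⟨φ.trans ψ.symm⟩
  -- The field structure is chosen to extend the given ring structure, so that the modules already
  -- constructed are unchanged.
  · obtain ⟨F, rfl⟩ : ∃ F : Field k, F.toCommRing = ‹CommRing k› := ⟨hk.toField, rfl⟩
    exact ⟨LRB.simple_supportModule, LRB.existsUnique_supportModule, fun X Y =>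
      ⟨LRB.quiverArrows_add_one k (he' Y), LRB.quiverArrows_eq_zero k (he' Y)⟩⟩
  · obtain ⟨F, rfl⟩ : ∃ F : Field k, F.toCommRing = ‹CommRing k› := ⟨hk.toField, rfl⟩
    exact LRB.exists_globalDimension_eq he'
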